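/- Let $\mathcal H$ be a separable complex Hilbert space and $\mathcal K=L^2(\mathbb R,\mathcal H,dt)$. A \emph{propagator} is a family of unitary operators $U(t,s)$, $t,s\in\mathbb R$, in $\mathcal H$ which is jointly strongly continuous and satisfies $U(t,r)U(r,s)=U(t,s)$ for all $t,r,s$. Let $-i\partial_t$ be the self-adjoint operator in $\mathcal K$ whose domain consists of the $f\in\mathcal K$ that are (after modification on a null set) absolutely continuous on every compact interval with $f'\in\mathcal K$. The \emph{quasi-energy operator} of a propagator $U$ is $K_U=\mathfrak U(-i\partial_t)\mathfrak U^{*}$ with $\mathfrak U=\int_{\mathbb R}^{\oplus}U(t,0)\,dt$. For a family $H(t)$, $t\in\mathbb R$, of self-adjoint operators in $\mathcal H$, let $\mathfrak H=\int_{\mathbb R}^{\oplus}H(t)\,dt$ be the operator in $\mathcal K$ with $f\in\operatorname{Dom}\mathfrak H$ iff $f(t)\in\operatorname{Dom}H(t)$ for a.e. $t$ and $t\mapsto H(t)f(t)$ lies in $\mathcal K$, and $(\mathfrak Hf)(t)=H(t)f(t)$. The propagator $U$ is \emph{weakly associated} to $H(t)$ if $\operatorname{Dom}(-i\partial_t)\cap\operatorname{Dom}\mathfrak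 H$ is dense in $\mathcal K$, the operator $-i\partial_t+\mathfrak H$ defined on it is closable, and $K_U=\overline{-i\partial_t+\mathfrak H}$. \textbf{Proposition.} Let $A(t)$, $t\in\mathbb R$, be bounded self-adjoint operators in $\mathcal H$ such that $t\mapsto A(t)\psi$ is (strongly, Lebesgue) measurable for every $\psi\in\mathcal H$ and $\|A(t)\|$ is bounded on every compact interval. Let $D\subset\mathcal H$ be a dense linear subspace and let $T(t)$, $t\in\mathbb R$, be a strongly continuous family of unitary operators in $\mathcal H$ such that (i) $T(t)D=D$ for all $t\in\mathbb R$; (ii) for every $\psi\in D$ the function $t\mapsto T(t)\psi$ is continuously differentiable; (iii) for every $t\in\mathbb R$ the operator $X(t)=i\dot T(t)T(t)^{-1}$ with $\operatorname{Dom}X(t)=D$ is self-adjoint. Then there is a unique propagator $C(t,s)$ given by the Dyson formula $$C(t,s)\psi=\sum_{n=0}^{\infty}(-i)^n\int_s^t ds_1\int_s^{s_1}ds_2\cdots\int_s^{s_{n-1}}ds_n\,A(s_1)A(s_2)\cdots A(s_n)\psi\qquad(t,s\in\mathbb R,\ \psi\in\mathcal H).$$ Moreover the operators $Y(t)=X(t)+T(t)A(t)T(t)^{-1}$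 with $\operatorname{Dom}Y(t)=D$ are self-adjoint, the propagator $T(t)C(t,s)T(s)^{-1}$ is weakly associated to the family $Y(t)$, and the operator $-i\partial_t+\int_{\mathbb R}^{\oplus}Y(t)\,dt$ is essentially self-adjoint in $\mathcal K$. -/

import Mathlib

open MeasureTheory Topology

namespace WeakAssoc

noncomputable section

variable {H : Type*} [NormedAddCommGroup H] [InnerProductSpace ℂ H]

/-! ### Strongly continuous families of unitary operators -/

theorem unitary_apply_continuous {X : Type*} [TopologicalSpace X] {W : X → H ≃ₗᵢ[ℂ] H}
    (hW : ∀ ψ, Continuous fun x => W x ψ) {f : X → H} (hf : Continuous f) :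
    Continuous fun x => W x (f x) := by
  rw [continuous_iff_continuousAt]
  intro x
  have h2 : Filter.Tendsto (fun y => ‖f y - f x‖) (𝓝 x) (𝓝 0) := by
    rw [← tendsto_iff_norm_sub_tendsto_zero]
    exact hf.continuousAt
  have h3 : Filter.Tendsto (fun y => W y (f y - f x)) (𝓝 x) (𝓝 0) := by
    rw [tendsto_zero_iff_norm_tendsto_zero]
    refine h2.congr fun y => ?_
    rw [LinearIsometryEquiv.norm_map]
  have h4 := h3.add ((hW (f x)).continuousAt (x := x)).tendsto
  simpa [ContinuousAt] using h4

theorem unitary_symm_continuous {X : Type*} [TopologicalSpace X] {W : X → H ≃ₗᵢ[ℂ] H}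
    (hW : ∀ ψ, Continuous fun x => W x ψ) (ψ : H) : Continuous fun x => (W x).symm ψ := by
  rw [continuous_iff_continuousAt]
  intro x
  have h1 : Filter.Tendsto (fun y => ‖W y ((W x).symm ψ) - W x ((W x).symm ψ)‖) (𝓝 x) (𝓝 0) := by
    rw [← tendsto_iff_norm_sub_tendsto_zero]
    exact (hW ((W x).symm ψ)).continuousAt
  rw [ContinuousAt, tendsto_iff_norm_sub_tendsto_zero]
  refine h1.congr fun y => ?_
  rw [← (W y).norm_map ((W y).symm ψ - (W x).symm ψ), map_sub, norm_sub_rev]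
  simp

/-- A propagator: a jointly strongly continuous family of unitary operators `U(t,s)` with
`U(t,r) U(r,s) = U(t,s)`. -/
@[ext]
structure Propagator (H : Type*) [NormedAddCommGroup H] [InnerProductSpace ℂ H] where
  /-- The unitary operator `U(t,s)`. -/
  op : ℝ → ℝ → H ≃ₗᵢ[ℂ] H
  continuous_op : ∀ ψ : H, Continuous fun p : ℝ × ℝ => op p.1 p.2 ψ
  chapman_kolmogorov : ∀ t r s : ℝ, ∀ ψ : H, op t r (op r s ψ) = op t s ψ

/-- The propagator `T(t) C(t,s) T(s)⁻¹`. -/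
def Propagator.conj (C : Propagator H) (T : ℝ → H ≃ₗᵢ[ℂ] H)
    (hT : ∀ ψ, Continuous fun t => T t ψ) : Propagator H where
  op t s := ((T s).symm.trans (C.op t s)).trans (T t)
  continuous_op ψ := by
    have h1 : Continuous fun p : ℝ × ℝ => (T p.2).symm ψ :=
      (unitary_symm_continuous hT ψ).comp continuous_snd
    have h2 : Continuous fun p : ℝ × ℝ => C.op p.1 p.2 ((T p.2).symm ψ) :=
      unitary_apply_continuous (W := fun p : ℝ × ℝ => C.op p.1 p.2) C.continuous_op h1
    exact unitary_apply_continuous (W := fun p : ℝ × ℝ => T p.1)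
      (fun φ => (hT φ).comp continuous_fst) h2
  chapman_kolmogorov t r s ψ := by
    simp [C.chapman_kolmogorov]

/-! ### The Dyson formula -/

/-- The iterated integral
`∫_s^t ds₁ ∫_s^{s₁} ds₂ … ∫_s^{s_{n-1}} dsₙ A(s₁) A(s₂) ⋯ A(sₙ) ψ`. -/
def dysonIntegral (A : ℝ → H →L[ℂ] H) : ℕ → ℝ → ℝ → H → H
  | 0, _, _, ψ => ψ
  | n + 1, t, s, ψ => ∫ u in s..t, A u (dysonIntegral A n u s ψ)

/-- `C(t,s) = ∑ₙ (-i)ⁿ ∫_s^t ds₁ ⋯ ∫_s^{s_{n-1}} dsₙ A(s₁) ⋯ A(sₙ)`, strongly. -/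
def IsDysonPropagator (A : ℝ → H →L[ℂ] H) (C : Propagator H) : Prop :=
  ∀ t s : ℝ, ∀ ψ : H,
    HasSum (fun n : ℕ => (-Complex.I) ^ n • dysonIntegral A n t s ψ) (C.op t s ψ)

/-! ### Operators in `𝒦 = L²(ℝ, H, dt)` -/

/-- The Hilbert space `𝒦 = L²(ℝ, H, dt)`. -/
abbrev LTwo (H : Type*) [NormedAddCommGroup H] : Type _ := Lp H 2 (volume : Measure ℝ)

theorem memLp_unitary_apply (W : ℝ → H ≃ₗᵢ[ℂ] H) (hW : ∀ ψ, Continuous fun t => W t ψ)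
    (f : LTwo H) : MemLp (fun t => W t (f t)) 2 (volume : Measure ℝ) :=
  (Lp.memLp f).of_le
    ((unitary_apply_continuous (X := ℝ × H) (W := fun p => W p.1)
      (fun ψ => (hW ψ).comp continuous_fst) continuous_snd).comp_aestronglyMeasurable
        (aestronglyMeasurable_id.prodMk (Lp.aestronglyMeasurable f)))
    (Filter.Eventually.of_forall fun t => by simp)

/-- The decomposable isometry `(∫^⊕ W(t) dt f)(t) = W(t) f(t)`. -/
def decomposableIsometry (W : ℝ → H ≃ₗᵢ[ℂ] H) (hW : ∀ ψ, Continuous fun t => W t ψ) :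
    LTwo H →ₗᵢ[ℂ] LTwo H :=
  have hm := memLp_unitary_apply W hW
  { toFun := fun f => (hm f).toLp _
    map_add' := fun f g => by
      ext1
      filter_upwards [(hm (f + g)).coeFn_toLp, (hm f).coeFn_toLp, (hm g).coeFn_toLp,
        Lp.coeFn_add f g, Lp.coeFn_add ((hm f).toLp _) ((hm g).toLp _)] with t h1 h2 h3 h4 h5
      rw [h1, h5, Pi.add_apply, h2, h3, h4, Pi.add_apply, map_add]
    map_smul' := fun c f => by
      ext1
      filter_upwards [(hm (c • f)).coeFn_toLp, (hm f).coeFn_toLp,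
        Lp.coeFn_smul c f, Lp.coeFn_smul c ((hm f).toLp _)] with t h1 h2 h3 h4
      rw [h1, RingHom.id_apply, h4, Pi.smul_apply, h2, h3, Pi.smul_apply, map_smul]
    norm_map' := fun f => by
      change ‖(hm f).toLp _‖ = ‖f‖
      rw [Lp.norm_def, Lp.norm_def]
      congr 1
      refine eLpNorm_congr_norm_ae ?_
      filter_upwards [(hm f).coeFn_toLp] with t h
      rw [h, LinearIsometryEquiv.norm_map] }

theorem decomposableIsometry_ae (W : ℝ → H ≃ₗᵢ[ℂ] H) (hW : ∀ ψ, Continuous fun t => W t ψ)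
    (f : LTwo H) : ∀ᵐ t, decomposableIsometry W hW f t = W t (f t) :=
  (memLp_unitary_apply W hW f).coeFn_toLp

/-- The unitary operator `∫^⊕ W(t) dt` in `𝒦`. -/
def decomposableUnitary (W : ℝ → H ≃ₗᵢ[ℂ] H) (hW : ∀ ψ, Continuous fun t => W t ψ) :
    LTwo H ≃ₗᵢ[ℂ] LTwo H :=
  LinearIsometryEquiv.ofSurjective (decomposableIsometry W hW) fun g =>
    ⟨decomposableIsometry (fun t => (W t).symm) (unitary_symm_continuous hW) g, by
      ext1
      filter_upwards [decomposableIsometry_ae W hW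
          (decomposableIsometry (fun t => (W t).symm) (unitary_symm_continuous hW) g),
        decomposableIsometry_ae (fun t => (W t).symm) (unitary_symm_continuous hW) g] with t h1 h2
      rw [h1, h2, LinearIsometryEquiv.apply_symm_apply]⟩

/-- The graph of `-i∂ₜ` in `𝒦`: the pairs `(f, g)` such that `f` has a representative `F` which is
absolutely continuous on every compact interval and a.e. differentiable, with `g = -iF'` a.e. -/
def derivGraph (H : Type*) [NormedAddCommGroup H] [InnerProductSpace ℂ H] :
    Submodule ℂ (LTwo H × LTwo H) where
  carrier := {p | ∃ F : ℝ → H, (∀ᵐ t, p.1 t = F t) ∧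
    (∀ a b : ℝ, AbsolutelyContinuousOnInterval F a b) ∧
    ∀ᵐ t, DifferentiableAt ℝ F t ∧ p.2 t = -Complex.I • deriv F t}
  zero_mem' := by
    refine ⟨fun _ => 0, ?_, fun a b => ?_, ?_⟩
    · exact Lp.coeFn_zero H 2 (volume : Measure ℝ)
    · exact (LipschitzWith.const (0 : H)).lipschitzOnWith.absolutelyContinuousOnInterval
    · filter_upwards [Lp.coeFn_zero H 2 (volume : Measure ℝ)] with t ht
      refine ⟨differentiableAt_const _, ?_⟩
      simp
  add_mem' := by
    rintro p q ⟨F, h1, h2, h3⟩ ⟨G, k1, k2, k3⟩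
    refine ⟨F + G, ?_, fun a b => (h2 a b).add (k2 a b), ?_⟩
    · filter_upwards [h1, k1, Lp.coeFn_add p.1 q.1] with t a b c
      rw [Prod.fst_add, c, Pi.add_apply, a, b, Pi.add_apply]
    · filter_upwards [h3, k3, Lp.coeFn_add p.2 q.2] with t a b c
      refine ⟨a.1.add b.1, ?_⟩
      rw [Prod.snd_add, c, Pi.add_apply, a.2, b.2, deriv_add a.1 b.1, smul_add]
  smul_mem' := by
    rintro c p ⟨F, h1, h2, h3⟩
    refine ⟨fun t => c • F t, ?_, fun a b => (h2 a b).const_smul c, ?_⟩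
    · filter_upwards [h1, Lp.coeFn_smul c p.1] with t a b
      rw [Prod.smul_fst, b, Pi.smul_apply, a]
    · filter_upwards [h3, Lp.coeFn_smul c p.2] with t a b
      refine ⟨a.1.const_smul c, ?_⟩
      rw [Prod.smul_snd, b, Pi.smul_apply, a.2, deriv_fun_const_smul c a.1, smul_comm]

/-- The self-adjoint operator `-i∂ₜ` in `𝒦`, with `f ∈ Dom` iff `f ∈ L²`, `f ∈ AC`, `f' ∈ L²`. -/
def derivOp (H : Type*) [NormedAddCommGroup H] [InnerProductSpace ℂ H] :
    LTwo H →ₗ.[ℂ] LTwo H :=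
  (derivGraph H).toLinearPMap

theorem derivOp_graph : (derivOp H).graph = derivGraph H := by
  refine Submodule.toLinearPMap_graph_eq _ ?_
  rintro p ⟨F, h1, h2, h3⟩ hp
  have hF : Continuous F := by
    rw [continuous_iff_continuousAt]
    intro t
    refine (h2 (t - 1) (t + 1)).continuousOn.continuousAt ?_
    rw [Set.uIcc_of_le (by linarith)]
    exact Icc_mem_nhds (by linarith) (by linarith)
  have hae : F =ᵐ[volume] fun _ => (0 : H) := by
    rw [hp] at h1
    filter_upwards [h1, Lp.coeFn_zero H 2 (volume : Measure ℝ)] with t a b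
    rw [← a, b, Pi.zero_apply]
  have h0 : F = fun _ => (0 : H) := MeasureTheory.Measure.eq_of_ae_eq hae hF continuous_const
  ext1
  filter_upwards [h3, Lp.coeFn_zero H 2 (volume : Measure ℝ)] with t a b
  rw [a.2, b, h0]
  simp

/-- The graph of the direct integral `∫^⊕ A(t) dt` of a family of operators: the pairs `(f, g)` in
`𝒦` with `f(t) ∈ Dom A(t)` and `g(t) = A(t) f(t)` for a.e. `t`. -/
def directIntegralGraph (A : ℝ → H →ₗ.[ℂ] H) : Submodule ℂ (LTwo H × LTwo H) where
  carrier := {p | ∀ᵐ t, ∃ h : p.1 t ∈ (A t).domain, p.2 t = A t ⟨p.1 t, h⟩}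
  zero_mem' := by
    filter_upwards [Lp.coeFn_zero H 2 (volume : Measure ℝ)] with t a
    have a1 : (0 : LTwo H × LTwo H).1 t = 0 := a
    have a2 : (0 : LTwo H × LTwo H).2 t = 0 := a
    refine ⟨by rw [a1]; exact (A t).domain.zero_mem, ?_⟩
    refine a2.trans ((A t).map_zero.symm.trans ?_)
    congr 1
    exact Subtype.ext a1.symm
  add_mem' := by
    rintro p q hp hq
    filter_upwards [hp, hq, Lp.coeFn_add p.1 q.1, Lp.coeFn_add p.2 q.2]
      with t ⟨a, a'⟩ ⟨b, b'⟩ c d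
    have c' : (p + q).1 t = p.1 t + q.1 t := c
    have d' : (p + q).2 t = p.2 t + q.2 t := d
    refine ⟨by rw [c']; exact (A t).domain.add_mem a b, ?_⟩
    rw [d', a', b', ← (A t).map_add]
    congr 1
    exact Subtype.ext c'.symm
  smul_mem' := by
    rintro k p hp
    filter_upwards [hp, Lp.coeFn_smul k p.1, Lp.coeFn_smul k p.2] with t ⟨a, a'⟩ c d
    have c' : (k • p).1 t = k • p.1 t := c
    have d' : (k • p).2 t = k • p.2 t := d
    refine ⟨by rw [c']; exact (A t).domain.smul_mem k a, ?_⟩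
    rw [d', a', ← (A t).map_smul]
    congr 1
    exact Subtype.ext c'.symm

/-- The direct integral `∫^⊕ A(t) dt` in `𝒦`: `f ∈ Dom` iff `f(t) ∈ Dom A(t)` for a.e. `t` and
`t ↦ A(t) f(t)` is square integrable. -/
def directIntegral (A : ℝ → H →ₗ.[ℂ] H) : LTwo H →ₗ.[ℂ] LTwo H :=
  (directIntegralGraph A).toLinearPMap

theorem directIntegral_graph (A : ℝ → H →ₗ.[ℂ] H) :
    (directIntegral A).graph = directIntegralGraph A := by
  refine Submodule.toLinearPMap_graph_eq _ ?_
  rintro p h hp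
  have h' : ∀ᵐ t, ∃ h : p.1 t ∈ (A t).domain, p.2 t = A t ⟨p.1 t, h⟩ := h
  ext1
  filter_upwards [h', Lp.coeFn_zero H 2 (volume : Measure ℝ)] with t ⟨a, a'⟩ b
  rw [a', b, Pi.zero_apply, ← (A t).map_zero]
  congr 1
  refine Subtype.ext ?_
  have hb : p.1 t = (0 : LTwo H) t := by rw [hp]
  exact hb.trans b

/-- The operator `V S V⁻¹` with domain `V (Dom S)`, for a unitary operator `V`. -/
def unitaryConj {E : Type*} [NormedAddCommGroup E] [InnerProductSpace ℂ E] (V : E ≃ₗᵢ[ℂ] E)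
    (S : E →ₗ.[ℂ] E) : E →ₗ.[ℂ] E where
  domain := S.domain.comap (V.symm.toLinearEquiv : E →ₗ[ℂ] E)
  toFun := (V.toLinearEquiv : E →ₗ[ℂ] E) ∘ₗ S.toFun ∘ₗ
    (V.symm.toLinearEquiv : E →ₗ[ℂ] E).restrict fun _ hx => hx

/-- The quasi-energy operator `K = 𝔘 (-i∂ₜ) 𝔘*` of a propagator, where `𝔘 = ∫^⊕ U(t,0) dt`. -/
def quasiEnergy (U : Propagator H) : LTwo H →ₗ.[ℂ] LTwo H :=
  unitaryConj
    (decomposableUnitary (fun t => U.op t 0)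
      fun ψ => (U.continuous_op ψ).comp (Continuous.prodMk_left 0))
    (derivOp H)

/-- The operator `-i∂ₜ + ∫^⊕ A(t) dt`, on the intersection of the two domains. -/
def floquet (A : ℝ → H →ₗ.[ℂ] H) : LTwo H →ₗ.[ℂ] LTwo H :=
  derivOp H + directIntegral A

/-- A densely defined closable operator is essentially self-adjoint if its closure is
self-adjoint. -/
def IsEssentiallySelfAdjoint {E : Type*} [NormedAddCommGroup E] [InnerProductSpace ℂ E]
    [CompleteSpace E] (S : E →ₗ.[ℂ] E) : Prop :=
  Dense (S.domain : Set E) ∧ S.IsClosable ∧ IsSelfAdjoint S.closure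

/-- The propagator `U(t,s)` is weakly associated to the family of self-adjoint operators `A(t)`:
the domain of `-i∂ₜ + ∫^⊕ A(t) dt` is dense in `𝒦`, and the closure of this operator is the
quasi-energy operator of `U`. -/
def WeaklyAssociated [CompleteSpace H] (U : Propagator H) (A : ℝ → H →ₗ.[ℂ] H) : Prop :=
  (∀ t, IsSelfAdjoint (A t)) ∧ Dense ((floquet A).domain : Set (LTwo H)) ∧
    (floquet A).IsClosable ∧ quasiEnergy U = (floquet A).closure

/-! ### The family `X(t) + T(t) A(t) T(t)⁻¹` -/

/-- The operator `X(t) = i Ṫ(t) T(t)⁻¹` with domain `D`. -/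
def generator (D : Submodule ℂ H) (T : ℝ → H ≃ₗᵢ[ℂ] H) (hTD : ∀ t, T t '' D = D)
    (hT : ∀ ψ ∈ D, ContDiff ℝ 1 fun t => T t ψ) (t : ℝ) : H →ₗ.[ℂ] H where
  domain := D
  toFun :=
    have hd : ∀ ψ : D, DifferentiableAt ℝ (fun u => T u ((T t).symm ψ)) t := fun ψ => by
      have hψ : (T t).symm (ψ : H) ∈ D := by
        obtain ⟨φ, hφ, h⟩ : (ψ : H) ∈ T t '' D := by rw [hTD t]; exact ψ.2
        rw [← h, LinearIsometryEquiv.symm_apply_apply]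
        exact hφ
      exact (hT _ hψ).differentiable one_ne_zero t
    { toFun := fun ψ => Complex.I • deriv (fun u => T u ((T t).symm (ψ : H))) t
      map_add' := fun ψ φ => by
        simp only [Submodule.coe_add, map_add]
        rw [deriv_fun_add (hd ψ) (hd φ), smul_add]
      map_smul' := fun c ψ => by
        simp only [Submodule.coe_smul, map_smul, RingHom.id_apply]
        rw [deriv_fun_const_smul c (hd ψ), smul_comm] }

/-- The bounded operator `T B T⁻¹`. -/
def conjBounded (T : H ≃ₗᵢ[ℂ] H) (B : H →L[ℂ] H) : H →ₗ[ℂ] H :=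
  (T.toLinearEquiv : H →ₗ[ℂ] H) ∘ₗ (B : H →ₗ[ℂ] H) ∘ₗ (T.symm.toLinearEquiv : H →ₗ[ℂ] H)

/-- The operator `Y(t) = X(t) + T(t) A(t) T(t)⁻¹` with domain `D`. -/
def perturbedGenerator (D : Submodule ℂ H) (T : ℝ → H ≃ₗᵢ[ℂ] H) (hTD : ∀ t, T t '' D = D)
    (hT : ∀ ψ ∈ D, ContDiff ℝ 1 fun t => T t ψ) (A : ℝ → H →L[ℂ] H) (t : ℝ) : H →ₗ.[ℂ] H :=
  conjBounded (T t) (A t) +ᵥ generator D T hTD hT t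

end

end WeakAssoc

namespace WeakAssoc

noncomputable section

variable {H : Type*} [NormedAddCommGroup H] [InnerProductSpace ℂ H]

section

/-! ### Primitives of locally integrable functions -/

/-! The Dyson series converges locally uniformly like an exponential series, and termwise
integration shows that its sum solves `i F' = A F` in integrated form. Since `A(t)` is self-adjoint,
solutions have constant norm (`IsSolution.norm_eq`). Hence a solution is determined by its value at
one time, and linearity, the propagator identity and unitarity of `C` all follow. Uniqueness of `C`
is immediate, because the series prescribes its operators.

Write `S = -i∂ₜ + ∫^⊕ Y(t) dt` and `K` for the quasi-energy operator of `T(t) C(t,s) T(s)⁻¹`. Both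
are symmetric and `S` is densely defined, so it suffices to prove `S* ⊆ K`: then `K ⊆ K* ⊆ S** = S̄
⊆ S* ⊆ K` and all of these coincide (`closure_eq_of_adjoint_le`).

For that inclusion, `S` is tested on `χ Tψ` with `ψ ∈ D` and `χ` a scalar test function. The
derivative of `T` cancels against `X`, leaving `T(-iχ'ψ + χAψ)` (`exists_mem_graph_floquet`). So if
`S*u = v`, then `T⁻¹u` has the weak derivative `i(T⁻¹v - A T⁻¹u)` and is absolutely continuous after
modification on a null set. Applying `C(0,t)` removes the `A` term (`IsPrimitive.propagator_apply`),
which says exactly that `u` lies in the domain of `K` and `Ku = v`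
(`adjoint_floquet_le_quasiEnergy`). -/

theorem absolutelyContinuousOnInterval_of_dist_le {X Y Z : Type*} [PseudoMetricSpace X]
    [PseudoMetricSpace Y] [PseudoMetricSpace Z] {f : ℝ → X} {g : ℝ → Y} {h : ℝ → Z} {a b C D : ℝ}
    (hf : AbsolutelyContinuousOnInterval f a b) (hg : AbsolutelyContinuousOnInterval g a b)
    (hle : ∀ x ∈ Set.uIcc a b, ∀ y ∈ Set.uIcc a b,
      dist (h x) (h y) ≤ C * dist (f x) (f y) + D * dist (g x) (g y)) :
    AbsolutelyContinuousOnInterval h a b := by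
  have key := (Filter.Tendsto.const_mul C hf).add (Filter.Tendsto.const_mul D hg)
  rw [mul_zero, mul_zero, add_zero] at key
  refine squeeze_zero' (Filter.Eventually.of_forall fun _ =>
    Finset.sum_nonneg fun _ _ => dist_nonneg) ?_ key
  have hm : ∀ᶠ E : ℕ × (ℕ → ℝ × ℝ) in AbsolutelyContinuousOnInterval.totalLengthFilter ⊓
      Filter.principal (AbsolutelyContinuousOnInterval.disjWithin a b),
      E ∈ AbsolutelyContinuousOnInterval.disjWithin a b :=
    Filter.eventually_inf_principal.mpr (by simp)
  filter_upwards [hm] with E hE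
  rw [Finset.mul_sum, Finset.mul_sum, ← Finset.sum_add_distrib]
  exact Finset.sum_le_sum fun i hi => hle _ (hE.1 i hi).1 _ (hE.1 i hi).2

theorem locallyIntegrable_of_norm_le {E G : Type*} [NormedAddCommGroup E] [NormedAddCommGroup G]
    {f : ℝ → E} {g : ℝ → G} (hf : AEStronglyMeasurable f volume) (hg : LocallyIntegrable g)
    (h : ∀ R : ℝ, ∃ C : ℝ, ∀ t ∈ Set.Icc (-R) R, ‖f t‖ ≤ C * ‖g t‖) : LocallyIntegrable f := by
  rw [locallyIntegrable_iff]
  intro K hK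
  obtain ⟨R, hR⟩ := hK.isBounded.subset_closedBall 0
  rw [Real.closedBall_eq_Icc, zero_sub, zero_add] at hR
  obtain ⟨C, hC⟩ := h R
  have h1 := (hg.integrableOn_isCompact (isCompact_Icc (a := -R) (b := R))).norm.const_mul C
  refine IntegrableOn.mono_set (Integrable.mono' h1 hf.restrict ?_) hR
  exact (ae_restrict_mem measurableSet_Icc).mono hC

theorem exists_norm_le_of_continuous {E : Type*} [NormedAddCommGroup E] {f : ℝ → E}
    (hf : Continuous f) (R : ℝ) : ∃ C : ℝ, ∀ t ∈ Set.Icc (-R) R, ‖f t‖ ≤ C :=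
  isCompact_Icc.exists_bound_of_continuousOn hf.continuousOn

theorem intervalIntegrable_of_locallyIntegrable {E : Type*} [NormedAddCommGroup E] {f : ℝ → E}
    (hf : LocallyIntegrable f) (a b : ℝ) : IntervalIntegrable f volume a b :=
  intervalIntegrable_iff.mpr
    ((hf.integrableOn_isCompact isCompact_uIcc).mono_set Set.uIoc_subset_uIcc)

/-- `F` is a primitive of the locally integrable function `p`. -/
structure IsPrimitive {E : Type*} [NormedAddCommGroup E] [NormedSpace ℝ E] (F p : ℝ → E) :
    Prop where
  locallyIntegrable : LocallyIntegrable p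
  sub_eq : ∀ a b, F b - F a = ∫ t in a..b, p t

namespace IsPrimitive

variable {E : Type*} [NormedAddCommGroup E] [NormedSpace ℝ E] {F G p q : ℝ → E}

theorem intervalIntegrable (h : IsPrimitive F p) (a b : ℝ) : IntervalIntegrable p volume a b :=
  intervalIntegrable_of_locallyIntegrable h.locallyIntegrable a b

theorem of_integral (hp : LocallyIntegrable p) (a : ℝ) (x : E) :
    IsPrimitive (fun t => x + ∫ u in a..t, p u) p where
  locallyIntegrable := hp
  sub_eq b c := by
    rw [add_sub_add_left_eq_sub]
    exact intervalIntegral.integral_interval_sub_left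
      (intervalIntegrable_of_locallyIntegrable hp _ _)
      (intervalIntegrable_of_locallyIntegrable hp _ _)

theorem eq_add (h : IsPrimitive F p) (a t : ℝ) : F t = F a + ∫ u in a..t, p u := by
  rw [← h.sub_eq, add_sub_cancel]

theorem congr (h : IsPrimitive F p) (hpq : p =ᵐ[volume] q) : IsPrimitive F q where
  locallyIntegrable := h.locallyIntegrable.congr hpq
  sub_eq a b := by
    rw [h.sub_eq]
    exact intervalIntegral.integral_congr_ae (hpq.mono fun _ h _ => h)

/-- The increments of `F` are dominated by those of the real primitive of `‖p‖`, which is absolutely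
continuous. -/
theorem absolutelyContinuousOnInterval (h : IsPrimitive F p) (a b : ℝ) :
    AbsolutelyContinuousOnInterval F a b := by
  have h1 := (h.intervalIntegrable a b).norm.absolutelyContinuousOnInterval_intervalIntegral
    (c := a) Set.left_mem_uIcc
  refine absolutelyContinuousOnInterval_of_dist_le (C := 1) (D := 0) h1 h1 fun x _ y _ => ?_
  rw [one_mul, zero_mul, add_zero, dist_comm, dist_eq_norm, h.sub_eq, dist_comm, Real.dist_eq,
    intervalIntegral.integral_interval_sub_left (h.intervalIntegrable _ _).norm
      (h.intervalIntegrable _ _).norm]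
  exact intervalIntegral.norm_integral_le_abs_integral_norm

theorem continuous (h : IsPrimitive F p) : Continuous F := by
  rw [continuous_iff_continuousAt]
  intro t
  refine (h.absolutelyContinuousOnInterval (t - 1) (t + 1)).continuousOn.continuousAt ?_
  rw [Set.uIcc_of_le (by linarith)]
  exact Icc_mem_nhds (by linarith) (by linarith)

theorem ae_hasDerivAt [CompleteSpace E] (h : IsPrimitive F p) : ∀ᵐ t, HasDerivAt F (p t) t := by
  filter_upwards [_root_.LocallyIntegrable.ae_hasDerivAt_integral h.locallyIntegrable] with t ht
  have h1 : F = fun t => F 0 + ∫ u in 0..t, p u := funext (h.eq_add 0)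
  rw [h1]
  exact (ht 0).const_add _

/-- The difference of `F` and the indefinite integral of `p` is absolutely continuous with
derivative zero a.e., hence constant. -/
theorem of_absolutelyContinuous [CompleteSpace E]
    (hF : ∀ a b, AbsolutelyContinuousOnInterval F a b)
    (hp : LocallyIntegrable p) (hd : ∀ᵐ t, HasDerivAt F (p t) t) : IsPrimitive F p where
  locallyIntegrable := hp
  sub_eq a b := by
    have h1 := of_integral hp a 0
    have h2 := (hF a b).sub (h1.absolutelyContinuousOnInterval a b)
    have h3 : ∀ᵐ t, t ∈ Set.uIcc a b →
        HasDerivAt (F - fun t => 0 + ∫ u in a..t, p u) 0 t := by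
      filter_upwards [hd, h1.ae_hasDerivAt] with t h4 h5 _
      simpa using h4.sub h5
    obtain ⟨c, hc⟩ := h2.const_of_ae_hasDerivAt_zero h3
    have ha := hc (x := a) Set.left_mem_uIcc
    have hb := hc (x := b) Set.right_mem_uIcc
    simp only [Pi.sub_apply, intervalIntegral.integral_same, zero_add, sub_zero] at ha hb
    rw [ha, ← hb]
    abel

theorem of_contDiff [CompleteSpace E] (hF : ContDiff ℝ 1 F) : IsPrimitive F (deriv F) :=
  of_absolutelyContinuous (fun _ _ => hF.contDiffOn.absolutelyContinuousOnInterval)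
    (hF.continuous_deriv le_rfl).locallyIntegrable
    (Filter.Eventually.of_forall fun t => (hF.differentiable one_ne_zero t).hasDerivAt)

theorem add (hF : IsPrimitive F p) (hG : IsPrimitive G q) :
    IsPrimitive (fun t => F t + G t) (fun t => p t + q t) where
  locallyIntegrable := hF.locallyIntegrable.add hG.locallyIntegrable
  sub_eq a b := by
    rw [intervalIntegral.integral_add (hF.intervalIntegrable a b) (hG.intervalIntegrable a b),
      ← hF.sub_eq, ← hG.sub_eq]
    abel

theorem sub (hF : IsPrimitive F p) (hG : IsPrimitive G q) :
    IsPrimitive (fun t => F t - G t) (fun t => p t - q t) where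
  locallyIntegrable := hF.locallyIntegrable.sub hG.locallyIntegrable
  sub_eq a b := by
    rw [intervalIntegral.integral_sub (hF.intervalIntegrable a b) (hG.intervalIntegrable a b),
      ← hF.sub_eq, ← hG.sub_eq]
    abel

theorem clm_apply [CompleteSpace E] {E' : Type*} [NormedAddCommGroup E'] [NormedSpace ℝ E']
    [CompleteSpace E'] (h : IsPrimitive F p) (L : E →L[ℝ] E') :
    IsPrimitive (fun t => L (F t)) (fun t => L (p t)) where
  locallyIntegrable := fun t => by
    obtain ⟨s, hs, hi⟩ := h.locallyIntegrable t
    exact ⟨s, hs, L.integrable_comp hi⟩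
  sub_eq a b := by
    rw [← map_sub, h.sub_eq, L.intervalIntegral_comp_comm (h.intervalIntegrable a b)]

/-- Both factors are bounded on compact intervals, so absolute continuity passes to the product, and
the product rule holds a.e. Every later integration by parts and the conservation of norm rest on
this. -/
theorem inner_right_left [CompleteSpace H] {F G p q : ℝ → H} (hF : IsPrimitive F p) (hG : IsPrimitive G q) :
    IsPrimitive (fun t => inner ℂ (F t) (G t))
      (fun t => inner ℂ (F t) (q t) + inner ℂ (p t) (G t)) := by
  refine of_absolutelyContinuous (fun a b => ?_) (LocallyIntegrable.add ?_ ?_) ?_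
  · have hFa := hF.absolutelyContinuousOnInterval a b
    have hGa := hG.absolutelyContinuousOnInterval a b
    obtain ⟨C, hC⟩ := hFa.exists_bound
    obtain ⟨D, hD⟩ := hGa.exists_bound
    refine absolutelyContinuousOnInterval_of_dist_le (C := D) (D := C) hFa hGa
      fun x hx y hy => ?_
    have e : inner ℂ (F x) (G x) - inner ℂ (F y) (G y) =
        inner ℂ (F x - F y) (G x) + inner ℂ (F y) (G x - G y) := by
      rw [inner_sub_left, inner_sub_right]; ring
    rw [dist_eq_norm, e, dist_eq_norm, dist_eq_norm]
    refine (norm_add_le _ _).trans (add_le_add ?_ ?_)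
    · refine (norm_inner_le_norm _ _).trans ?_
      rw [mul_comm]
      exact mul_le_mul_of_nonneg_right (hD x hx) (norm_nonneg _)
    · refine (norm_inner_le_norm _ _).trans ?_
      exact mul_le_mul_of_nonneg_right (hC y hy) (norm_nonneg _)
  · refine locallyIntegrable_of_norm_le
      (hF.continuous.aestronglyMeasurable.inner hG.locallyIntegrable.aestronglyMeasurable)
      hG.locallyIntegrable fun R => ?_
    obtain ⟨C, hC⟩ := exists_norm_le_of_continuous hF.continuous R
    exact ⟨C, fun t ht => (norm_inner_le_norm _ _).trans
      (mul_le_mul_of_nonneg_right (hC t ht) (norm_nonneg _))⟩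
  · refine locallyIntegrable_of_norm_le
      (hF.locallyIntegrable.aestronglyMeasurable.inner hG.continuous.aestronglyMeasurable)
      hF.locallyIntegrable fun R => ?_
    obtain ⟨C, hC⟩ := exists_norm_le_of_continuous hG.continuous R
    refine ⟨C, fun t ht => (norm_inner_le_norm _ _).trans ?_⟩
    rw [mul_comm]
    exact mul_le_mul_of_nonneg_right (hC t ht) (norm_nonneg _)
  · filter_upwards [hF.ae_hasDerivAt, hG.ae_hasDerivAt] with t h1 h2
    exact h1.inner ℂ h2

/-- An integrable primitive of an integrable function vanishes at infinity. -/
theorem integral_eq_zero [CompleteSpace E] (h : IsPrimitive F p) (hF : Integrable F)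
    (hp : Integrable p) : ∫ t, p t = 0 := by
  have h1 : Filter.Tendsto F Filter.atTop (𝓝 (F 0 + ∫ t in Set.Ioi 0, p t)) := by
    have := (intervalIntegral_tendsto_integral_Ioi 0 hp.integrableOn Filter.tendsto_id).const_add
      (F 0)
    exact this.congr fun t => (h.eq_add 0 t).symm
  have h2 : Filter.Tendsto F Filter.atBot (𝓝 (F 0 - ∫ t in Set.Iic 0, p t)) := by
    have := (intervalIntegral_tendsto_integral_Iic 0 hp.integrableOn Filter.tendsto_id).const_sub
      (F 0)
    refine this.congr fun t => ?_
    rw [h.eq_add 0 t, intervalIntegral.integral_symm, sub_neg_eq_add, id]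
  -- Integrability of `p` gives `F` limits at both ends. Neighbourhoods of `±∞` have infinite
  -- measure, so an integrable `F` can only tend to zero there.
  have h3 : F 0 + ∫ t in Set.Ioi 0, p t = 0 := by
    refine IntegrableAtFilter.eq_zero_of_tendsto (μ := volume)
      ⟨Set.univ, Filter.univ_mem, hF.integrableOn⟩ (fun s hs => ?_) h1
    obtain ⟨b, hb⟩ := Filter.mem_atTop_sets.1 hs
    rw [← top_le_iff, ← Real.volume_Ici (a := b)]
    exact measure_mono hb
  have h4 : F 0 - ∫ t in Set.Iic 0, p t = 0 := by
    refine IntegrableAtFilter.eq_zero_of_tendsto (μ := volume)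
      ⟨Set.univ, Filter.univ_mem, hF.integrableOn⟩ (fun s hs => ?_) h2
    obtain ⟨b, hb⟩ := Filter.mem_atBot_sets.1 hs
    rw [← top_le_iff, ← Real.volume_Iic (a := b)]
    exact measure_mono hb
  rw [← intervalIntegral.integral_Iic_add_Ioi (b := 0) hp.integrableOn hp.integrableOn,
    ← sub_eq_zero.1 h4, h3]

end IsPrimitive

/-- The fundamental theorem of calculus trades a.e. differentiability for an integral equation; `g =
-iF'` becomes `F' = ig`. -/
theorem mem_derivGraph_iff [CompleteSpace H] {f g : LTwo H} :
    (f, g) ∈ derivGraph H ↔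
      ∃ F : ℝ → H, f =ᵐ[volume] F ∧ IsPrimitive F fun t => Complex.I • g t := by
  constructor
  · rintro ⟨F, h1, h2, h3⟩
    refine ⟨F, h1, IsPrimitive.of_absolutelyContinuous h2
      (((Lp.memLp g).locallyIntegrable (by norm_num)).smul Complex.I) ?_⟩
    filter_upwards [h3] with t ht
    have h4 : Complex.I • g t = deriv F t := by
      rw [ht.2, smul_smul]
      simp
    rw [h4]
    exact ht.1.hasDerivAt
  · rintro ⟨F, h1, h2⟩
    refine ⟨F, h1, h2.absolutelyContinuousOnInterval, ?_⟩
    filter_upwards [h2.ae_hasDerivAt] with t ht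
    refine ⟨ht.differentiableAt, ?_⟩
    rw [ht.deriv, smul_smul]
    simp

/-- The operator `-i∂ₜ` is symmetric. -/
theorem derivGraph_inner_eq [CompleteSpace H] {f g f' g' : LTwo H} (h : (f, g) ∈ derivGraph H)
    (h' : (f', g') ∈ derivGraph H) : inner ℂ g f' = inner ℂ f g' := by
  obtain ⟨F, h1, h2⟩ := mem_derivGraph_iff.1 h
  obtain ⟨F', h1', h2'⟩ := mem_derivGraph_iff.1 h'
  -- The left side is the derivative of the integrable function `⟨F, F'⟩`, so its integral over the
  -- line vanishes.
  have e : (fun t => inner ℂ (F t) (Complex.I • g' t) + inner ℂ (Complex.I • g t) (F' t))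
      =ᵐ[volume] fun t => Complex.I * (inner ℂ (f t) (g' t) - inner ℂ (g t) (f' t)) := by
    filter_upwards [h1, h1'] with t a b
    rw [a, b, inner_smul_left, inner_smul_right, Complex.conj_I]
    ring
  have h3 := (h2.inner_right_left h2').congr e
  have i1 := L2.integrable_inner (𝕜 := ℂ) f g'
  have i2 := L2.integrable_inner (𝕜 := ℂ) g f'
  have i3 : Integrable fun t => inner ℂ (F t) (F' t) := by
    refine (L2.integrable_inner (𝕜 := ℂ) f f').congr ?_
    filter_upwards [h1, h1'] with t a b
    rw [a, b]
  have h4 := h3.integral_eq_zero i3 ((i1.sub i2).const_mul _)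
  rw [integral_const_mul, integral_sub i1 i2, ← L2.inner_def, ← L2.inner_def] at h4
  exact (sub_eq_zero.1 ((mul_eq_zero.1 h4).resolve_left Complex.I_ne_zero)).symm

end

section

/-! ### Strongly measurable, locally bounded families of operators -/

/-- For a simple function only finitely many fixed vectors occur. The general case is a pointwise
limit, by continuity of each `A t`. -/
theorem aestronglyMeasurable_family_apply {A : ℝ → H →L[ℂ] H}
    (hA_meas : ∀ ψ : H, AEStronglyMeasurable (fun t => A t ψ) (volume : Measure ℝ)) {f : ℝ → H}
    (hf : AEStronglyMeasurable f volume) :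
    AEStronglyMeasurable (fun t => A t (f t)) (volume : Measure ℝ) := by
  obtain ⟨g, hg, hfg⟩ := hf
  suffices h : AEStronglyMeasurable (fun t => A t (g t)) (volume : Measure ℝ) by
    refine h.congr ?_
    filter_upwards [hfg] with t ht
    rw [ht]
  have key : ∀ s : SimpleFunc ℝ H,
      AEStronglyMeasurable (fun t => A t (s t)) (volume : Measure ℝ) := fun s => by
    have e : (fun t => A t (s t)) =
        fun t => ∑ c ∈ s.range, (s ⁻¹' {c}).indicator (fun t => A t c) t := by
      funext t
      rw [Finset.sum_eq_single (s t)]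
      · rw [Set.indicator_of_mem (by simp)]
      · intro c _ hc
        exact Set.indicator_of_notMem (by simpa using hc.symm) _
      · intro h
        exact absurd (s.mem_range_self t) h
    rw [e]
    exact Finset.aestronglyMeasurable_fun_sum _ fun c _ =>
      (hA_meas c).indicator (s.measurableSet_fiber c)
  exact aestronglyMeasurable_of_tendsto_ae Filter.atTop (fun n => key (hg.approx n))
    (Filter.Eventually.of_forall fun t =>
      ((A t).continuous.tendsto _).comp (hg.tendsto_approx t))

theorem locallyIntegrable_family_apply {A : ℝ → H →L[ℂ] H}
    (hA_meas : ∀ ψ : H, AEStronglyMeasurable (fun t => A t ψ) (volume : Measure ℝ))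
    (hA_bdd : ∀ a b : ℝ, ∃ M : ℝ, ∀ t ∈ Set.Icc a b, ‖A t‖ ≤ M) {f : ℝ → H}
    (hf : LocallyIntegrable f) : LocallyIntegrable fun t => A t (f t) := by
  refine locallyIntegrable_of_norm_le
    (aestronglyMeasurable_family_apply hA_meas hf.aestronglyMeasurable) hf fun R => ?_
  obtain ⟨M, hM⟩ := hA_bdd (-R) R
  exact ⟨M, fun t ht => (A t).le_of_opNorm_le (hM t ht) _⟩

/-! ### Convergence of the Dyson series -/

/-- The factor `|t - s| ^ n / n!` is the volume of the simplex of ordered times. Absolute values let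
one induction cover both orders of `s` and `t`. -/
theorem norm_dysonIntegral_le {A : ℝ → H →L[ℂ] H} {R M : ℝ} (hM0 : 0 ≤ M)
    (hM : ∀ t ∈ Set.Icc (-R) R, ‖A t‖ ≤ M) {s : ℝ} (hs : s ∈ Set.Icc (-R) R) (ψ : H) (n : ℕ) :
    ∀ t ∈ Set.Icc (-R) R,
      ‖dysonIntegral A n t s ψ‖ ≤ M ^ n * ‖ψ‖ / n.factorial * |t - s| ^ n := by
  induction n with
  | zero => intro t _; simp [dysonIntegral]
  | succ n ih =>
    intro t ht
    have h1 : ‖∫ u in s..t, A u (dysonIntegral A n u s ψ)‖ ≤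
        |∫ u in s..t, M * (M ^ n * ‖ψ‖ / n.factorial) * |u - s| ^ n| := by
      refine intervalIntegral.norm_integral_le_abs_of_norm_le ?_ ?_
      · refine (ae_restrict_mem measurableSet_uIoc).mono fun u hu => ?_
        have hu' : u ∈ Set.Icc (-R) R :=
          Set.uIcc_subset_Icc hs ht (Set.uIoc_subset_uIcc hu)
        refine ((A u).le_of_opNorm_le (hM u hu') _).trans ?_
        rw [mul_assoc]
        exact mul_le_mul_of_nonneg_left (ih u hu') hM0
      · exact Continuous.intervalIntegrable (by fun_prop) _ _
    refine h1.trans (le_of_eq ?_)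
    rw [intervalIntegral.abs_intervalIntegral_eq, integral_const_mul, integral_pow_abs_sub_uIoc,
      abs_of_nonneg (by positivity), Nat.factorial_succ]
    push_cast
    field_simp
    ring

/-- The sum of the Dyson series. -/
def dysonSum (A : ℝ → H →L[ℂ] H) (t s : ℝ) (ψ : H) : H :=
  ∑' n : ℕ, (-Complex.I) ^ n • dysonIntegral A n t s ψ

/-- Using `|t - s| ≤ 2R` frees the bound from `t`: the exponential series then serves as majorant
for uniform and for dominated convergence. -/
theorem norm_dyson_term_le {A : ℝ → H →L[ℂ] H} {R M : ℝ} (hM0 : 0 ≤ M)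
    (hM : ∀ t ∈ Set.Icc (-R) R, ‖A t‖ ≤ M) {s : ℝ} (hs : s ∈ Set.Icc (-R) R) (ψ : H) (n : ℕ)
    {t : ℝ} (ht : t ∈ Set.Icc (-R) R) :
    ‖(-Complex.I) ^ n • dysonIntegral A n t s ψ‖ ≤
      (M * (2 * R)) ^ n / n.factorial * ‖ψ‖ := by
  rw [norm_smul, norm_pow, norm_neg, Complex.norm_I, one_pow, one_mul]
  refine (norm_dysonIntegral_le hM0 hM hs ψ n t ht).trans ?_
  have h1 : |t - s| ≤ 2 * R := by
    rw [abs_le]; constructor <;> linarith [ht.1, ht.2, hs.1, hs.2]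
  have h2 : |t - s| ^ n ≤ (2 * R) ^ n := pow_le_pow_left₀ (abs_nonneg _) h1 n
  calc M ^ n * ‖ψ‖ / n.factorial * |t - s| ^ n ≤ M ^ n * ‖ψ‖ / n.factorial * (2 * R) ^ n :=
        mul_le_mul_of_nonneg_left h2 (by positivity)
    _ = (M * (2 * R)) ^ n / n.factorial * ‖ψ‖ := by rw [mul_pow]; ring

theorem exists_norm_family_le {A : ℝ → H →L[ℂ] H}
    (hA_bdd : ∀ a b : ℝ, ∃ M : ℝ, ∀ t ∈ Set.Icc a b, ‖A t‖ ≤ M) (R : ℝ) :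
    ∃ M : ℝ, 0 ≤ M ∧ ∀ t ∈ Set.Icc (-R) R, ‖A t‖ ≤ M := by
  obtain ⟨M, hM⟩ := hA_bdd (-R) R
  exact ⟨max M 0, le_max_right _ _, fun t ht => (hM t ht).trans (le_max_left _ _)⟩

section Dyson

variable {A : ℝ → H →L[ℂ] H}

theorem hasSum_dysonSum [CompleteSpace H] (hA_bdd : ∀ a b : ℝ, ∃ M : ℝ, ∀ t ∈ Set.Icc a b, ‖A t‖ ≤ M)
    (t s : ℝ) (ψ : H) :
    HasSum (fun n : ℕ => (-Complex.I) ^ n • dysonIntegral A n t s ψ) (dysonSum A t s ψ) := by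
  obtain ⟨M, hM0, hM⟩ := exists_norm_family_le hA_bdd (max |t| |s|)
  exact (Summable.of_norm_bounded ((Real.summable_pow_div_factorial _).mul_right _) fun n =>
    norm_dyson_term_le hM0 hM (abs_le.1 (le_max_right |t| |s|)) ψ n
      (abs_le.1 (le_max_left |t| |s|))).hasSum

theorem continuous_dysonIntegral
    (hA_meas : ∀ ψ : H, AEStronglyMeasurable (fun t => A t ψ) (volume : Measure ℝ))
    (hA_bdd : ∀ a b : ℝ, ∃ M : ℝ, ∀ t ∈ Set.Icc a b, ‖A t‖ ≤ M) (s : ℝ) (ψ : H) (n : ℕ) :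
    Continuous fun t => dysonIntegral A n t s ψ := by
  induction n with
  | zero => exact continuous_const
  | succ n ih =>
    have h := (IsPrimitive.of_integral
      (locallyIntegrable_family_apply hA_meas hA_bdd ih.locallyIntegrable) s (0 : H)).continuous
    simpa [dysonIntegral] using h

theorem continuous_dysonSum [CompleteSpace H]
    (hA_meas : ∀ ψ : H, AEStronglyMeasurable (fun t => A t ψ) (volume : Measure ℝ))
    (hA_bdd : ∀ a b : ℝ, ∃ M : ℝ, ∀ t ∈ Set.Icc a b, ‖A t‖ ≤ M) (s : ℝ) (ψ : H) :
    Continuous fun t => dysonSum A t s ψ := by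
  rw [continuous_iff_continuousAt]
  intro t
  -- The interval `[-R, R]` must contain `s` and be a neighbourhood of `t`, whence the extra `1`.
  set R := max (|t| + 1) |s| with hR
  obtain ⟨M, hM0, hM⟩ := exists_norm_family_le hA_bdd R
  have h1 : ContinuousOn (fun t => dysonSum A t s ψ) (Set.Icc (-R) R) :=
    continuousOn_tsum
      (fun n => ((continuous_dysonIntegral hA_meas hA_bdd s ψ n).const_smul _).continuousOn)
      ((Real.summable_pow_div_factorial _).mul_right _)
      fun n u hu => norm_dyson_term_le hM0 hM (abs_le.1 (le_max_right _ _)) ψ n hu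
  refine h1.continuousAt (Icc_mem_nhds ?_ ?_)
  · have := neg_abs_le t
    have := le_max_left (|t| + 1) |s|
    linarith
  · have := le_abs_self t
    have := le_max_left (|t| + 1) |s|
    linarith

/-- `F` solves `i F' = A F` in the integrated sense. -/
def IsSolution (A : ℝ → H →L[ℂ] H) (F : ℝ → H) : Prop :=
  IsPrimitive F fun t => -Complex.I • A t (F t)

theorem IsSolution.sub {F G : ℝ → H} (hF : IsSolution A F) (hG : IsSolution A G) :
    IsSolution A fun t => F t - G t := by
  simpa only [IsSolution, ← smul_sub, ← map_sub] using IsPrimitive.sub hF hG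

theorem IsSolution.add {F G : ℝ → H} (hF : IsSolution A F) (hG : IsSolution A G) :
    IsSolution A fun t => F t + G t := by
  simpa only [IsSolution, ← smul_add, ← map_add] using IsPrimitive.add hF hG

/-! ### Integral equation, conservation of norm and unitarity of the Dyson series. -/

variable [CompleteSpace H]

/-- Once the zeroth term `ψ` is split off, term `n + 1` is the integral of `-iA` applied to term
`n`; dominated convergence sums these integrals. -/
theorem dysonSum_eq
    (hA_meas : ∀ ψ : H, AEStronglyMeasurable (fun t => A t ψ) (volume : Measure ℝ))
    (hA_bdd : ∀ a b : ℝ, ∃ M : ℝ, ∀ t ∈ Set.Icc a b, ‖A t‖ ≤ M) (t s : ℝ) (ψ : H) :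
    dysonSum A t s ψ = ψ + ∫ u in s..t, -Complex.I • A u (dysonSum A u s ψ) := by
  have h1 := hasSum_dysonSum hA_bdd t s ψ
  rw [← hasSum_nat_add_iff' 1] at h1
  obtain ⟨M, hM0, hM⟩ := exists_norm_family_le hA_bdd (max |t| |s|)
  have ht : t ∈ Set.Icc (-(max |t| |s|)) (max |t| |s|) := abs_le.1 (le_max_left |t| |s|)
  have hs : s ∈ Set.Icc (-(max |t| |s|)) (max |t| |s|) := abs_le.1 (le_max_right |t| |s|)
  have hsum := ((Real.summable_pow_div_factorial (M * (2 * max |t| |s|))).mul_right ‖ψ‖).mul_left M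
  have h2 : HasSum (fun n : ℕ => ∫ u in s..t,
      -Complex.I • A u ((-Complex.I) ^ n • dysonIntegral A n u s ψ))
      (∫ u in s..t, -Complex.I • A u (dysonSum A u s ψ)) := by
    refine intervalIntegral.hasSum_integral_of_dominated_convergence
      (fun n _ => M * ((M * (2 * max |t| |s|)) ^ n / n.factorial * ‖ψ‖)) (fun n => ?_)
      (fun n => ?_) (Filter.Eventually.of_forall fun u _ => hsum) intervalIntegrable_const
      (Filter.Eventually.of_forall fun u _ => ?_)
    · exact ((aestronglyMeasurable_family_apply hA_meas
        ((continuous_dysonIntegral hA_meas hA_bdd s ψ n).const_smul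
          _).aestronglyMeasurable).const_smul _).restrict
    · refine Filter.Eventually.of_forall fun u hu => ?_
      have hu' := Set.uIcc_subset_Icc hs ht (Set.uIoc_subset_uIcc hu)
      rw [norm_smul, norm_neg, Complex.norm_I, one_mul]
      exact ((A u).le_of_opNorm_le (hM u hu') _).trans
        (mul_le_mul_of_nonneg_left (norm_dyson_term_le hM0 hM hs ψ n hu') hM0)
    · exact ((A u).hasSum (hasSum_dysonSum hA_bdd u s ψ)).const_smul _
  have h3 : (fun n : ℕ => ∫ u in s..t,
      -Complex.I • A u ((-Complex.I) ^ n • dysonIntegral A n u s ψ)) =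
      fun n : ℕ => (-Complex.I) ^ (n + 1) • dysonIntegral A (n + 1) t s ψ := by
    funext n
    simp only [map_smul, smul_smul, ← pow_succ', dysonIntegral]
    rw [intervalIntegral.integral_smul]
  rw [h3] at h2
  have h4 := h1.unique h2
  rw [← h4]
  simp [dysonIntegral]

theorem IsSolution.const_smul {F : ℝ → H} (hF : IsSolution A F) (c : ℂ) :
    IsSolution A fun t => c • F t := by
  have := IsPrimitive.clm_apply hF ((c • ContinuousLinearMap.id ℂ H).restrictScalars ℝ)
  simpa [IsSolution, smul_comm c] using this

/-- The derivative of `‖F‖²` is zero because `⟨F, A F⟩` is real. This yields uniqueness of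
solutions, without a Gronwall estimate, as well as isometry. -/
theorem IsSolution.norm_eq (hA_sa : ∀ t, IsSelfAdjoint (A t)) {F : ℝ → H} (hF : IsSolution A F)
    (t s : ℝ) : ‖F t‖ = ‖F s‖ := by
  have h1 := IsPrimitive.inner_right_left hF hF
  have h2 : ∀ t, inner ℂ (F t) (-Complex.I • A t (F t)) +
      inner ℂ (-Complex.I • A t (F t)) (F t) = 0 := fun t => by
    rw [inner_smul_right, inner_smul_left, map_neg, Complex.conj_I,
      (ContinuousLinearMap.isSelfAdjoint_iff_isSymmetric.1 (hA_sa t)).apply_clm (F t) (F t)]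
    ring
  have h3 := h1.sub_eq s t
  simp only [h2, intervalIntegral.integral_zero, inner_self_eq_norm_sq_to_K] at h3
  have h4 : ‖F t‖ ^ 2 = ‖F s‖ ^ 2 := by exact_mod_cast sub_eq_zero.1 h3
  exact (sq_eq_sq₀ (norm_nonneg _) (norm_nonneg _)).1 h4

theorem IsSolution.eq (hA_sa : ∀ t, IsSelfAdjoint (A t)) {F G : ℝ → H} (hF : IsSolution A F)
    (hG : IsSolution A G) {s : ℝ} (h : F s = G s) (t : ℝ) : F t = G t := by
  have h1 := (hF.sub hG).norm_eq hA_sa t s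
  rw [h, sub_self, norm_zero, norm_eq_zero] at h1
  exact sub_eq_zero.1 h1

theorem isSolution_dysonSum
    (hA_meas : ∀ ψ : H, AEStronglyMeasurable (fun t => A t ψ) (volume : Measure ℝ))
    (hA_bdd : ∀ a b : ℝ, ∃ M : ℝ, ∀ t ∈ Set.Icc a b, ‖A t‖ ≤ M) (s : ℝ) (ψ : H) :
    IsSolution A fun t => dysonSum A t s ψ := by
  have h := IsPrimitive.of_integral ((locallyIntegrable_family_apply hA_meas hA_bdd
    (continuous_dysonSum hA_meas hA_bdd s ψ).locallyIntegrable).smul (-Complex.I)) s ψ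
  have e := funext fun t => dysonSum_eq hA_meas hA_bdd t s ψ
  exact ⟨h.locallyIntegrable, fun a b => (congrArg₂ (· - ·) (congrFun e b) (congrFun e a)).trans
    (h.sub_eq a b)⟩

theorem dysonSum_self
    (hA_meas : ∀ ψ : H, AEStronglyMeasurable (fun t => A t ψ) (volume : Measure ℝ))
    (hA_bdd : ∀ a b : ℝ, ∃ M : ℝ, ∀ t ∈ Set.Icc a b, ‖A t‖ ≤ M) (s : ℝ) (ψ : H) :
    dysonSum A s s ψ = ψ := by
  rw [dysonSum_eq hA_meas hA_bdd, intervalIntegral.integral_same, add_zero]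

/-- As functions of `t` both sides are solutions, and they agree at `t = r`. -/
theorem dysonSum_dysonSum (hA_sa : ∀ t, IsSelfAdjoint (A t))
    (hA_meas : ∀ ψ : H, AEStronglyMeasurable (fun t => A t ψ) (volume : Measure ℝ))
    (hA_bdd : ∀ a b : ℝ, ∃ M : ℝ, ∀ t ∈ Set.Icc a b, ‖A t‖ ≤ M) (t r s : ℝ) (ψ : H) :
    dysonSum A t r (dysonSum A r s ψ) = dysonSum A t s ψ :=
  (isSolution_dysonSum hA_meas hA_bdd r _).eq hA_sa (isSolution_dysonSum hA_meas hA_bdd s ψ)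
    (dysonSum_self hA_meas hA_bdd r _) t

/-- The unitary operator given by the Dyson series. -/
def dysonOp (hA_sa : ∀ t, IsSelfAdjoint (A t))
    (hA_meas : ∀ ψ : H, AEStronglyMeasurable (fun t => A t ψ) (volume : Measure ℝ))
    (hA_bdd : ∀ a b : ℝ, ∃ M : ℝ, ∀ t ∈ Set.Icc a b, ‖A t‖ ≤ M) (t s : ℝ) : H ≃ₗᵢ[ℂ] H where
  toFun := dysonSum A t s
  map_add' ψ φ := by
    refine (isSolution_dysonSum hA_meas hA_bdd s _).eq hA_sa
      ((isSolution_dysonSum hA_meas hA_bdd s ψ).add (isSolution_dysonSum hA_meas hA_bdd s φ))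
      (s := s) ?_ t
    simp only [dysonSum_self hA_meas hA_bdd]
  map_smul' c ψ := by
    refine (isSolution_dysonSum hA_meas hA_bdd s _).eq hA_sa
      ((isSolution_dysonSum hA_meas hA_bdd s ψ).const_smul c) (s := s) ?_ t
    simp only [dysonSum_self hA_meas hA_bdd]
  invFun := dysonSum A s t
  left_inv ψ := by
    rw [dysonSum_dysonSum hA_sa hA_meas hA_bdd, dysonSum_self hA_meas hA_bdd]
  right_inv ψ := by
    rw [dysonSum_dysonSum hA_sa hA_meas hA_bdd, dysonSum_self hA_meas hA_bdd]
  norm_map' ψ := by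
    refine ((isSolution_dysonSum hA_meas hA_bdd s ψ).norm_eq hA_sa t s).trans ?_
    rw [dysonSum_self hA_meas hA_bdd]

/-- The propagator given by the Dyson series. -/
def dysonPropagator (hA_sa : ∀ t, IsSelfAdjoint (A t))
    (hA_meas : ∀ ψ : H, AEStronglyMeasurable (fun t => A t ψ) (volume : Measure ℝ))
    (hA_bdd : ∀ a b : ℝ, ∃ M : ℝ, ∀ t ∈ Set.Icc a b, ‖A t‖ ≤ M) : Propagator H where
  op := dysonOp hA_sa hA_meas hA_bdd
  chapman_kolmogorov := dysonSum_dysonSum hA_sa hA_meas hA_bdd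
  continuous_op ψ := by
    have h1 : ∀ φ, Continuous fun t => dysonOp hA_sa hA_meas hA_bdd t 0 φ :=
      continuous_dysonSum hA_meas hA_bdd 0
    -- Factoring `C(t,s) = C(t,0) C(s,0)⁻¹` reduces joint continuity to continuity in the first
    -- variable.
    have h2 : Continuous fun p : ℝ × ℝ => dysonOp hA_sa hA_meas hA_bdd p.1 0
        ((dysonOp hA_sa hA_meas hA_bdd p.2 0).symm ψ) :=
      unitary_apply_continuous (W := fun p : ℝ × ℝ => dysonOp hA_sa hA_meas hA_bdd p.1 0)
        (fun φ => (h1 φ).comp continuous_fst)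
        ((unitary_symm_continuous h1 ψ).comp continuous_snd)
    refine h2.congr fun p => ?_
    exact dysonSum_dysonSum hA_sa hA_meas hA_bdd p.1 0 p.2 ψ

theorem existsUnique_isDysonPropagator (hA_sa : ∀ t, IsSelfAdjoint (A t))
    (hA_meas : ∀ ψ : H, AEStronglyMeasurable (fun t => A t ψ) (volume : Measure ℝ))
    (hA_bdd : ∀ a b : ℝ, ∃ M : ℝ, ∀ t ∈ Set.Icc a b, ‖A t‖ ≤ M) :
    ∃! C : Propagator H, IsDysonPropagator A C := by
  refine ⟨dysonPropagator hA_sa hA_meas hA_bdd, fun t s ψ => hasSum_dysonSum hA_bdd t s ψ,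
    fun C hC => ?_⟩
  ext t s ψ
  exact (hC t s ψ).unique (hasSum_dysonSum hA_bdd t s ψ)

theorem IsDysonPropagator.isSolution
    (hA_meas : ∀ ψ : H, AEStronglyMeasurable (fun t => A t ψ) (volume : Measure ℝ))
    (hA_bdd : ∀ a b : ℝ, ∃ M : ℝ, ∀ t ∈ Set.Icc a b, ‖A t‖ ≤ M) {C : Propagator H}
    (hC : IsDysonPropagator A C) (s : ℝ) (ψ : H) : IsSolution A fun t => C.op t s ψ := by
  have e : (fun t => C.op t s ψ) = fun t => dysonSum A t s ψ :=
    funext fun t => (hC t s ψ).unique (hasSum_dysonSum hA_bdd t s ψ)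
  rw [e]
  exact isSolution_dysonSum hA_meas hA_bdd s ψ

end Dyson

theorem Propagator.op_self (C : Propagator H) (t : ℝ) (ψ : H) : C.op t t ψ = ψ :=
  (C.op t t).injective (C.chapman_kolmogorov t t t ψ)

theorem Propagator.symm_op (C : Propagator H) (t s : ℝ) (ψ : H) :
    (C.op t s).symm ψ = C.op s t ψ := by
  rw [LinearIsometryEquiv.symm_apply_eq, C.chapman_kolmogorov, C.op_self]

end

section

/-! ### Graphs of unbounded operators -/

section Graph

variable {E : Type*} [NormedAddCommGroup E] [InnerProductSpace ℂ E]

theorem mem_graph_vadd_iff {L : E →ₗ[ℂ] E} {S : E →ₗ.[ℂ] E} {x y : E} :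
    (x, y) ∈ (L +ᵥ S).graph ↔ (x, y - L x) ∈ S.graph := by
  rw [LinearPMap.mem_graph_iff, LinearPMap.mem_graph_iff]
  constructor
  · rintro ⟨z, hz, h⟩
    refine ⟨z, hz, ?_⟩
    simp only at hz h ⊢
    rw [← h, ← hz, LinearPMap.vadd_apply, add_sub_cancel_left]
  · rintro ⟨z, hz, h⟩
    refine ⟨z, hz, ?_⟩
    simp only at hz h ⊢
    rw [LinearPMap.vadd_apply, h, hz, add_sub_cancel]

theorem mem_graph_add_iff {S T : E →ₗ.[ℂ] E} {x y : E} :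
    (x, y) ∈ (S + T).graph ↔ ∃ y₁ y₂, (x, y₁) ∈ S.graph ∧ (x, y₂) ∈ T.graph ∧ y = y₁ + y₂ := by
  constructor
  · intro h
    obtain ⟨z, hz, hy⟩ := (LinearPMap.mem_graph_iff _).1 h
    simp only at hz hy
    subst hz
    exact ⟨_, _, S.mem_graph ⟨z, z.2.1⟩, T.mem_graph ⟨z, z.2.2⟩, hy.symm⟩
  · rintro ⟨y₁, y₂, h₁, h₂, rfl⟩
    obtain ⟨z₁, hz₁, e₁⟩ := (LinearPMap.mem_graph_iff _).1 h₁
    obtain ⟨z₂, hz₂, e₂⟩ := (LinearPMap.mem_graph_iff _).1 h₂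
    simp only at hz₁ e₁ hz₂ e₂
    subst hz₁ e₁ e₂
    obtain ⟨z₂, m₂⟩ := z₂
    simp only at hz₂
    subst hz₂
    exact (S + T).mem_graph ⟨z₁, z₁.2, m₂⟩

theorem mem_graph_unitaryConj_iff {V : E ≃ₗᵢ[ℂ] E} {S : E →ₗ.[ℂ] E} {x y : E} :
    (x, y) ∈ (unitaryConj V S).graph ↔ (V.symm x, V.symm y) ∈ S.graph := by
  constructor
  · intro h
    obtain ⟨z, hz, hy⟩ := (LinearPMap.mem_graph_iff _).1 h
    simp only at hz hy
    subst hz hy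
    refine (LinearPMap.mem_graph_iff _).2 ⟨⟨V.symm z, z.2⟩, rfl, ?_⟩
    exact (V.symm_apply_apply _).symm
  · intro h
    obtain ⟨⟨z, m⟩, hz, hy⟩ := (LinearPMap.mem_graph_iff _).1 h
    simp only at hz hy
    subst hz
    refine (LinearPMap.mem_graph_iff _).2 ⟨⟨x, m⟩, rfl, ?_⟩
    rw [← V.apply_symm_apply y, ← hy]
    rfl

/-- The graph `g` is that of a symmetric operator. -/
def IsSymmetricGraph (g : Submodule ℂ (E × E)) : Prop :=
  ∀ p ∈ g, ∀ q ∈ g, inner ℂ p.2 q.1 = inner ℂ p.1 q.2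

theorem mem_adjoint_iff' {g : Submodule ℂ (E × E)} {x y : E} :
    (x, y) ∈ g.adjoint ↔ ∀ p ∈ g, inner ℂ p.2 x = inner ℂ p.1 y := by
  rw [Submodule.mem_adjoint_iff]
  simp only [sub_eq_zero, Prod.forall]

theorem IsSymmetricGraph.le_adjoint {g : Submodule ℂ (E × E)} (hg : IsSymmetricGraph g) :
    g ≤ g.adjoint := fun q hq => mem_adjoint_iff'.2 fun p hp => hg p hp q hq

theorem IsSymmetricGraph.unitaryConj {V : E ≃ₗᵢ[ℂ] E} {S : E →ₗ.[ℂ] E}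
    (hS : IsSymmetricGraph S.graph) : IsSymmetricGraph (unitaryConj V S).graph := by
  rintro ⟨x, y⟩ hp ⟨x', y'⟩ hq
  have h := hS _ (mem_graph_unitaryConj_iff.1 hp) _ (mem_graph_unitaryConj_iff.1 hq)
  simpa only [LinearIsometryEquiv.inner_map_map] using h

theorem adjoint_anti {g k : Submodule ℂ (E × E)} (h : g ≤ k) : k.adjoint ≤ g.adjoint :=
  fun _ hq => mem_adjoint_iff'.2 fun p hp => mem_adjoint_iff'.1 hq p (h hp)

/-! ### Self-adjointness, double adjoints and closures. -/

variable [CompleteSpace E]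

theorem isSymmetricGraph_of_isSelfAdjoint {S : E →ₗ.[ℂ] E} (hS : IsSelfAdjoint S) :
    IsSymmetricGraph S.graph := by
  intro p hp q hq
  have h := LinearPMap.adjoint_graph_eq_graph_adjoint hS.dense_domain
  rw [LinearPMap.isSelfAdjoint_def.1 hS] at h
  rw [h] at hq
  exact mem_adjoint_iff'.1 hq p hp

/-- A self-adjoint operator perturbed by an everywhere defined symmetric operator is
self-adjoint. -/
theorem isSelfAdjoint_vadd {L : E →ₗ[ℂ] E} (hL : L.IsSymmetric) {S : E →ₗ.[ℂ] E}
    (hS : IsSelfAdjoint S) : IsSelfAdjoint (L +ᵥ S) := by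
  have hd : Dense ((L +ᵥ S).domain : Set E) := hS.dense_domain
  have hg := LinearPMap.adjoint_graph_eq_graph_adjoint hS.dense_domain
  rw [LinearPMap.isSelfAdjoint_def.1 hS] at hg
  rw [LinearPMap.isSelfAdjoint_def]
  refine LinearPMap.eq_of_eq_graph ?_
  rw [LinearPMap.adjoint_graph_eq_graph_adjoint hd]
  ext ⟨y, z⟩
  rw [mem_graph_vadd_iff, hg, mem_adjoint_iff', mem_adjoint_iff']
  constructor
  · rintro h ⟨a, b⟩ hab
    have h1 := h (a, b + L a) (mem_graph_vadd_iff.2 (by simpa using hab))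
    simp only at h1 ⊢
    rw [inner_sub_right, ← h1, inner_add_left, hL a y, add_sub_cancel_right]
  · rintro h ⟨a, b⟩ hab
    have h1 := h _ (mem_graph_vadd_iff.1 hab)
    simp only at h1 ⊢
    rw [inner_sub_left, inner_sub_right, hL a y] at h1
    exact sub_left_injective h1

/-- The adjoint graph is the orthogonal complement rotated by `(a, b) ↦ (b, -a)`, so the double
adjoint lies in the double orthogonal complement, which is the closure. `WithLp 2` supplies the
Hilbert structure on the product. -/
theorem adjoint_adjoint_le_topologicalClosure (g : Submodule ℂ (E × E)) :
    g.adjoint.adjoint ≤ g.topologicalClosure := by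
  rintro ⟨x, y⟩ hxy
  let e : E × E →ₗ[ℂ] WithLp 2 (E × E) := (WithLp.linearEquiv 2 ℂ (E × E)).symm.toLinearMap
  have h1 : WithLp.toLp 2 (x, y) ∈ (g.map e)ᗮᗮ := by
    rw [Submodule.mem_orthogonal]
    intro p hp
    rw [Submodule.mem_orthogonal] at hp
    have h2 : (p.snd, -p.fst) ∈ g.adjoint := mem_adjoint_iff'.2 fun q hq => by
      have h3 := hp (WithLp.toLp 2 q) ⟨q, hq, rfl⟩
      rw [WithLp.prod_inner_apply] at h3
      rw [inner_neg_right]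
      exact eq_neg_of_add_eq_zero_right h3
    have h4 := mem_adjoint_iff'.1 hxy _ h2
    simp only [inner_neg_left] at h4
    rw [WithLp.prod_inner_apply]
    exact (neg_eq_iff_add_eq_zero).1 h4
  rw [Submodule.orthogonal_orthogonal_eq_closure] at h1
  have h5 := map_mem_closure (WithLp.prod_continuous_ofLp 2 E E) h1
    (t := (g : Set (E × E))) (by rintro _ ⟨q, hq, rfl⟩; exact hq)
  exact h5

/-- If `S` is densely defined and symmetric, and its adjoint is contained in the symmetric operator
`K`, then `K` is the closure of `S` and it is self-adjoint. -/
theorem closure_eq_of_adjoint_le {S K : E →ₗ.[ℂ] E} (hd : Dense (S.domain : Set E))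
    (hS : IsSymmetricGraph S.graph) (hK : IsSymmetricGraph K.graph)
    (h : S.graph.adjoint ≤ K.graph) :
    S.IsClosable ∧ K = S.closure ∧ IsSelfAdjoint S.closure := by
  have hadj := LinearPMap.adjoint_graph_eq_graph_adjoint hd
  have hcl : S.adjoint.IsClosed := LinearPMap.adjoint_isClosed hd
  have hle : S ≤ S.adjoint := LinearPMap.le_of_le_graph (by rw [hadj]; exact hS.le_adjoint)
  have hc : S.IsClosable := hcl.isClosable.leIsClosable hle
  have hgc := hc.graph_closure_eq_closure_graph
  have h1 : S.closure.graph ≤ S.graph.adjoint := by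
    rw [← hgc, ← hadj]
    exact Submodule.topologicalClosure_minimal _ (by rw [hadj]; exact hS.le_adjoint) hcl
  -- The chain is `K ⊆ K* ⊆ S** ⊆ S̄`; the converse comes from `S̄ ⊆ S* ⊆ K`.
  have h2 : K.graph ≤ S.closure.graph := by
    rw [← hgc]
    exact (hK.le_adjoint.trans (adjoint_anti h)).trans (adjoint_adjoint_le_topologicalClosure _)
  have hKS : K = S.closure := LinearPMap.eq_of_eq_graph (le_antisymm h2 (h1.trans h))
  refine ⟨hc, hKS, ?_⟩
  have hdc : Dense (S.closure.domain : Set E) := hd.mono S.le_closure.1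
  rw [LinearPMap.isSelfAdjoint_def]
  refine LinearPMap.eq_of_eq_graph ?_
  rw [LinearPMap.adjoint_graph_eq_graph_adjoint hdc]
  refine le_antisymm ?_ ?_
  · exact (adjoint_anti (LinearPMap.le_graph_of_le S.le_closure)).trans (h.trans h2)
  · rw [← hKS]
    exact hK.le_adjoint

end Graph

/-! ### Weak derivatives -/

open scoped ContDiff

/-- Du Bois-Reymond's argument: with `∫ θ = 1`, every test function `g` equals `(∫ g) θ` plus the
derivative of a test function, so `z` acts on `g` as the constant `∫ θ z` does. -/
theorem ae_eq_const_of_integral_deriv_smul_eq_zero {E : Type*} [NormedAddCommGroup E]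
    [NormedSpace ℝ E] [CompleteSpace E] {z : ℝ → E} (hz : LocallyIntegrable z)
    (h : ∀ χ : ℝ → ℝ, ContDiff ℝ ∞ χ → HasCompactSupport χ → ∫ t, deriv χ t • z t = 0) :
    ∃ c : E, ∀ᵐ t, z t = c := by
  let b : ContDiffBump (0 : ℝ) := ⟨1, 2, one_pos, one_lt_two⟩
  let θ : ℝ → ℝ := b.normed volume
  have hθ : ContDiff ℝ ∞ θ := b.contDiff_normed
  have hθc : HasCompactSupport θ := b.hasCompactSupport_normed
  have hθ1 : ∫ t, θ t = 1 := b.integral_normed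
  have hint : ∀ g : ℝ → ℝ, ContDiff ℝ ∞ g → HasCompactSupport g →
      Integrable fun t => g t • z t := fun g hg hgc =>
    hz.integrable_smul_left_of_hasCompactSupport hg.continuous hgc
  refine ⟨∫ t, θ t • z t, ?_⟩
  set c := ∫ t, θ t • z t with hc
  have key : ∀ᵐ t, z t - c = 0 := by
    refine ae_eq_zero_of_integral_contDiff_smul_eq_zero
      (hz.sub (locallyIntegrable_const c)) fun g hg hgc => ?_
    set m := ∫ t, g t with hm
    let k : ℝ → ℝ := fun t => g t - m * θ t
    have hk : ContDiff ℝ ∞ k := hg.sub (contDiff_const.mul hθ)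
    have hkc : HasCompactSupport k := hgc.sub (hθc.mul_left (f := fun _ => m))
    have hgi : Integrable g := hg.continuous.integrable_of_hasCompactSupport hgc
    have hθi : Integrable θ := hθ.continuous.integrable_of_hasCompactSupport hθc
    have hki : Integrable k := hgi.sub (hθi.const_mul m)
    have hk0 : ∫ t, k t = 0 := by
      simp only [k]
      rw [integral_sub hgi (hθi.const_mul m), integral_const_mul, hθ1, mul_one, sub_self]
    obtain ⟨R, hR⟩ := hkc.isCompact.isBounded.subset_ball 0
    rw [Real.ball_eq_Ioo, zero_sub, zero_add] at hR
    have hkR : ∀ t, t ∉ Set.Ioo (-R) R → k t = 0 := fun t ht =>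
      image_eq_zero_of_notMem_tsupport fun h => ht (hR h)
    let χ : ℝ → ℝ := fun t => ∫ u in -R..t, k u
    have hχd : ∀ t, HasDerivAt χ (k t) t := fun t =>
      hk.continuous.integral_hasStrictDerivAt _ _ |>.hasDerivAt
    have hχ' : deriv χ = k := funext fun t => (hχd t).deriv
    have hχ : ContDiff ℝ ∞ χ := by
      rw [contDiff_infty_iff_deriv, hχ']
      exact ⟨fun t => (hχd t).differentiableAt, hk⟩
    -- Left of `-R` the integrand vanishes; right of `R` the integral is all of `∫ k = 0`.
    have hχc : HasCompactSupport χ := by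
      refine HasCompactSupport.intro (isCompact_Icc (a := -R) (b := R)) fun t ht => ?_
      by_cases h1 : t < -R
      · refine intervalIntegral.integral_zero_ae (Filter.Eventually.of_forall fun u hu => ?_)
        rw [Set.uIoc_of_ge h1.le] at hu
        exact hkR u fun h => absurd hu.2 (not_le.2 h.1)
      · have h2 : R < t := by
          by_contra h2
          exact ht ⟨not_lt.1 h1, not_lt.1 h2⟩
        refine (intervalIntegral.integral_eq_integral_of_support_subset fun u hu => ?_).trans hk0
        have h3 : u ∈ Set.Ioo (-R) R := by
          by_contra h3
          exact hu (hkR u h3)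
        exact ⟨h3.1, h3.2.le.trans h2.le⟩
    have h1 := h χ hχ hχc
    rw [hχ'] at h1
    have h2 : (fun t => k t • z t) = fun t => g t • z t - m • (θ t • z t) := by
      funext t
      simp only [k, sub_smul, mul_smul]
    have hθz : Integrable fun t => m • (θ t • z t) := (hint θ hθ hθc).smul m
    rw [h2, integral_sub (hint g hg hgc) hθz, integral_smul, ← hc] at h1
    have h3 : (fun t => g t • (z t - c)) = fun t => g t • z t - g t • c :=
      funext fun t => smul_sub _ _ _
    rw [h3, integral_sub (hint g hg hgc) (hgi.smul_const c), integral_smul_const, h1]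
  exact key.mono fun t ht => sub_eq_zero.1 ht

theorem integrable_mul_inner {χ : ℝ → ℝ} (hχ : Continuous χ) (hχc : HasCompactSupport χ)
    {z : ℝ → H} (hz : LocallyIntegrable z) (ψ : H) :
    Integrable fun t => (χ t : ℂ) * inner ℂ ψ (z t) := by
  have h := (hz.integrable_smul_left_of_hasCompactSupport hχ hχc).const_inner (𝕜 := ℂ) ψ
  refine h.congr (Filter.Eventually.of_forall fun t => ?_)
  simp only
  rw [← Complex.coe_smul, inner_smul_right]

variable [CompleteSpace H]

/-- Vectors of `D` are the only ones on which `T` is differentiable, so weak identities are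
available only against them; density makes that enough. -/
theorem integral_smul_eq_zero_of_inner {D : Submodule ℂ H} (hD : Dense (D : Set H)) {χ : ℝ → ℝ}
    {z : ℝ → H} (hi : Integrable fun t => χ t • z t)
    (h : ∀ ψ ∈ D, ∫ t, (χ t : ℂ) * inner ℂ ψ (z t) = 0) : ∫ t, χ t • z t = 0 := by
  refine hD.eq_zero_of_inner_right ℂ fun ψ hψ => ?_
  rw [← integral_inner hi ψ, ← h ψ hψ]
  refine integral_congr_ae (Filter.Eventually.of_forall fun t => ?_)
  simp only
  rw [← Complex.coe_smul, inner_smul_right]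

theorem ae_eq_zero_of_integral_mul_inner {D : Submodule ℂ H} (hD : Dense (D : Set H)) {z : ℝ → H}
    (hz : LocallyIntegrable z)
    (h : ∀ χ : ℝ → ℝ, ContDiff ℝ ∞ χ → HasCompactSupport χ → ∀ ψ ∈ D,
      ∫ t, (χ t : ℂ) * inner ℂ ψ (z t) = 0) : ∀ᵐ t, z t = 0 :=
  ae_eq_zero_of_integral_contDiff_smul_eq_zero hz fun χ hχ hχc =>
    integral_smul_eq_zero_of_inner hD
      (hz.integrable_smul_left_of_hasCompactSupport hχ.continuous hχc) (h χ hχ hχc)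

/-- Integration by parts against a compactly supported function. -/
theorem IsPrimitive.integral_deriv_mul_inner {W w : ℝ → H} (hW : IsPrimitive W w) {χ : ℝ → ℝ}
    (hχ : ContDiff ℝ ∞ χ) (hχc : HasCompactSupport χ) (ψ : H) :
    ∫ t, ((deriv χ t : ℝ) : ℂ) * inner ℂ ψ (W t) = -∫ t, (χ t : ℂ) * inner ℂ ψ (w t) := by
  have hχ1 : ContDiff ℝ 1 χ := hχ.of_le (by exact_mod_cast le_top)
  have hd : ∀ t, HasDerivAt (fun t => χ t • ψ) (deriv χ t • ψ) t := fun t =>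
    ((hχ1.differentiable one_ne_zero t).hasDerivAt).smul_const ψ
  have h1 : IsPrimitive (fun t => χ t • ψ) fun t => deriv χ t • ψ := by
    have : IsPrimitive (fun t => χ t • ψ) (deriv fun t => χ t • ψ) :=
      IsPrimitive.of_contDiff (hχ1.smul (contDiff_const (c := ψ)))
    rwa [show deriv (fun t => χ t • ψ) = fun t => deriv χ t • ψ from
      funext fun t => (hd t).deriv] at this
  have e : ∀ (r : ℝ) (x : H), inner ℂ (r • ψ) x = (r : ℂ) * inner ℂ ψ x := fun r x => by
    rw [← Complex.coe_smul, inner_smul_left, Complex.conj_ofReal]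
  have h2 := h1.inner_right_left hW
  simp only [e] at h2
  have i1 := integrable_mul_inner hχ.continuous hχc hW.continuous.locallyIntegrable ψ
  have i2 := integrable_mul_inner hχ.continuous hχc hW.locallyIntegrable ψ
  have i3 := integrable_mul_inner (hχ1.continuous_deriv le_rfl) hχc.deriv
    hW.continuous.locallyIntegrable ψ
  have h3 := h2.integral_eq_zero i1 (i2.add i3)
  rw [integral_add i2 i3] at h3
  exact eq_neg_of_add_eq_zero_right h3

/-- A function with a locally integrable weak derivative agrees a.e. with a primitive of it. -/
theorem exists_isPrimitive_of_weak_deriv {D : Submodule ℂ H} (hD : Dense (D : Set H))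
    {z w : ℝ → H} (hz : LocallyIntegrable z) (hw : LocallyIntegrable w)
    (h : ∀ χ : ℝ → ℝ, ContDiff ℝ ∞ χ → HasCompactSupport χ → ∀ ψ ∈ D,
      ∫ t, ((deriv χ t : ℝ) : ℂ) * inner ℂ ψ (z t) = -∫ t, (χ t : ℂ) * inner ℂ ψ (w t)) :
    ∃ W : ℝ → H, z =ᵐ[volume] W ∧ IsPrimitive W w := by
  have h0 := IsPrimitive.of_integral hw 0 (0 : H)
  set W₀ : ℝ → H := fun t => 0 + ∫ u in 0..t, w u
  have hW₀ := h0.continuous.locallyIntegrable (μ := volume)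
  have hzW : LocallyIntegrable fun t => z t - W₀ t := hz.sub hW₀
  -- Both `z` and `W₀` have weak derivative `w`, so their difference is a.e. constant.
  obtain ⟨c, hc⟩ := ae_eq_const_of_integral_deriv_smul_eq_zero hzW fun χ hχ hχc => by
    have hχ' : Continuous (deriv χ) := hχ.continuous_deriv (by exact_mod_cast le_top)
    refine integral_smul_eq_zero_of_inner hD
      (hzW.integrable_smul_left_of_hasCompactSupport hχ' hχc.deriv) fun ψ hψ => ?_
    simp only [inner_sub_right, mul_sub]
    rw [integral_sub (integrable_mul_inner hχ' hχc.deriv hz ψ)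
      (integrable_mul_inner hχ' hχc.deriv hW₀ ψ), h χ hχ hχc ψ hψ,
      h0.integral_deriv_mul_inner hχ hχc ψ, sub_self]
  refine ⟨fun t => c + ∫ u in 0..t, w u, ?_, IsPrimitive.of_integral hw 0 c⟩
  filter_upwards [hc] with t ht
  rw [← ht]
  simp [W₀]

end

section

open scoped ContDiff

/-! ### Symmetry of the operators in `𝒦` -/

theorem decomposableUnitary_symm_ae (W : ℝ → H ≃ₗᵢ[ℂ] H) (hW : ∀ ψ, Continuous fun t => W t ψ)
    (f : LTwo H) : ∀ᵐ t, (decomposableUnitary W hW).symm f t = (W t).symm (f t) := by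
  have h : decomposableIsometry W hW ((decomposableUnitary W hW).symm f) = f :=
    (decomposableUnitary W hW).apply_symm_apply f
  filter_upwards [decomposableIsometry_ae W hW ((decomposableUnitary W hW).symm f)] with t ht
  rw [h] at ht
  rw [ht, LinearIsometryEquiv.symm_apply_apply]

theorem memLp_symm_apply {T : ℝ → H ≃ₗᵢ[ℂ] H}
    (hT_cont : ∀ ψ : H, Continuous fun t => T t ψ) (u : LTwo H) :
    MemLp (fun t => (T t).symm (u t)) 2 (volume : Measure ℝ) :=
  memLp_unitary_apply (fun t => (T t).symm) (unitary_symm_continuous hT_cont) u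

theorem isSymmetricGraph_directIntegral {B : ℝ → H →ₗ.[ℂ] H}
    (hB : ∀ t, IsSymmetricGraph (B t).graph) : IsSymmetricGraph (directIntegral B).graph := by
  rw [directIntegral_graph]
  intro p hp q hq
  rw [L2.inner_def, L2.inner_def]
  refine integral_congr_ae ?_
  have hp' : ∀ᵐ t, ∃ h : p.1 t ∈ (B t).domain, p.2 t = B t ⟨p.1 t, h⟩ := hp
  have hq' : ∀ᵐ t, ∃ h : q.1 t ∈ (B t).domain, q.2 t = B t ⟨q.1 t, h⟩ := hq
  filter_upwards [hp', hq'] with t ⟨a, a'⟩ ⟨b, b'⟩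
  have h := hB t _ ((B t).mem_graph ⟨p.1 t, a⟩) _ ((B t).mem_graph ⟨q.1 t, b⟩)
  rw [a', b']
  exact h

/-- The real factor `r` will be `χ t`; the term with `deriv` is the one that cancels against `-i∂ₜ(χ
Tψ)`. -/
theorem perturbedGenerator_apply {A : ℝ → H →L[ℂ] H} {D : Submodule ℂ H} {T : ℝ → H ≃ₗᵢ[ℂ] H}
    {hT_D : ∀ t, T t '' D = D} {hT_C1 : ∀ ψ ∈ D, ContDiff ℝ 1 fun t => T t ψ} {t : ℝ} {ψ : H} (hψ : ψ ∈ D) (r : ℝ)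
    (h : r • T t ψ ∈ (perturbedGenerator D T hT_D hT_C1 A t).domain) :
    perturbedGenerator D T hT_D hT_C1 A t ⟨r • T t ψ, h⟩ =
      r • (Complex.I • deriv (fun u => T u ψ) t + T t (A t ψ)) := by
  have e1 : ∀ u, T u ((T t).symm (r • T t ψ)) = r • T u ψ := fun u => by
    rw [← Complex.coe_smul, ← Complex.coe_smul, map_smul, map_smul,
      LinearIsometryEquiv.symm_apply_apply]
  have e2 : conjBounded (T t) (A t) (r • T t ψ) = r • T t (A t ψ) := by
    rw [← Complex.coe_smul, ← Complex.coe_smul, map_smul]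
    change _ • T t (A t ((T t).symm (T t ψ))) = _
    rw [LinearIsometryEquiv.symm_apply_apply]
  have e3 : generator D T hT_D hT_C1 t ⟨r • T t ψ, h⟩ =
      r • Complex.I • deriv (fun u => T u ψ) t := by
    change Complex.I • deriv (fun u => T u ((T t).symm (r • T t ψ))) t = _
    simp only [e1]
    rw [deriv_fun_const_smul r ((hT_C1 ψ hψ).differentiable one_ne_zero t), smul_comm]
  refine (LinearPMap.vadd_apply _ _ _).trans ?_
  rw [smul_add, add_comm]
  exact congrArg₂ (· + ·) e3 e2

variable [CompleteSpace H]

theorem isSymmetricGraph_derivOp : IsSymmetricGraph (derivOp H).graph := by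
  rw [derivOp_graph]
  exact fun p hp q hq => derivGraph_inner_eq hp hq

theorem isSymmetricGraph_floquet {B : ℝ → H →ₗ.[ℂ] H}
    (hB : ∀ t, IsSymmetricGraph (B t).graph) : IsSymmetricGraph (floquet B).graph := by
  rintro ⟨x, y⟩ hp ⟨x', y'⟩ hq
  obtain ⟨y₁, y₂, h₁, h₂, rfl⟩ := mem_graph_add_iff.1 hp
  obtain ⟨z₁, z₂, k₁, k₂, rfl⟩ := mem_graph_add_iff.1 hq
  have e₁ := isSymmetricGraph_derivOp _ h₁ _ k₁
  have e₂ := isSymmetricGraph_directIntegral hB _ h₂ _ k₂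
  simp only at e₁ e₂ ⊢
  rw [inner_add_left, inner_add_right, e₁, e₂]

/-! ### The interaction picture -/

/-- If `W` solves `-i W' + A W = v`, then `-i (C(0,t) W)' = C(0,t) v`. -/
theorem IsPrimitive.propagator_apply {A : ℝ → H →L[ℂ] H} (hA_sa : ∀ t, IsSelfAdjoint (A t))
    {C : Propagator H} (hC : ∀ φ, IsSolution A fun t => C.op t 0 φ) {W v : ℝ → H}
    (hv : MemLp v 2 (volume : Measure ℝ))
    (hW : IsPrimitive W fun t => Complex.I • (v t - A t (W t))) :
    IsPrimitive (fun t => C.op 0 t (W t)) fun t => Complex.I • C.op 0 t (v t) := by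
  have hC' : ∀ ψ, Continuous fun t => C.op 0 t ψ := fun ψ =>
    (C.continuous_op ψ).comp (Continuous.prodMk_right 0)
  have hm : MemLp (fun t => Complex.I • C.op 0 t (v t)) 2 (volume : Measure ℝ) := by
    have h1 := (memLp_unitary_apply (fun t => C.op 0 t) hC' (hv.toLp v)).const_smul Complex.I
    refine h1.ae_eq ?_
    filter_upwards [hv.coeFn_toLp] with t ht
    simp only [Pi.smul_apply]
    rw [ht]
  have hl : LocallyIntegrable fun t => Complex.I • C.op 0 t (v t) :=
    hm.locallyIntegrable (by norm_num)
  refine ⟨hl, fun a b => ?_⟩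
  -- Moving the unitary onto `φ` leaves a product of two primitives, so `C(0,t)` itself is never
  -- differentiated. The two terms with `A` then cancel by self-adjointness.
  have e : ∀ t φ x, inner ℂ φ (C.op 0 t x) = inner ℂ (C.op t 0 φ) x := fun t φ x => by
    rw [← LinearIsometryEquiv.inner_map_map (C.op t 0) φ, C.chapman_kolmogorov, C.op_self]
  refine ext_inner_left ℂ fun φ => ?_
  have h2 := (IsPrimitive.inner_right_left (hC φ) hW).sub_eq a b
  rw [inner_sub_right, e, e, h2]
  have h3 := (innerSL ℂ φ).intervalIntegral_comp_comm
    (intervalIntegrable_of_locallyIntegrable hl a b)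
  simp only [innerSL_apply_apply] at h3
  rw [← h3]
  refine intervalIntegral.integral_congr fun t _ => ?_
  simp only
  rw [inner_smul_right, inner_smul_right, inner_smul_left, e, inner_sub_right, map_neg,
    Complex.conj_I, (ContinuousLinearMap.isSelfAdjoint_iff_isSymmetric.1 (hA_sa t)).apply_clm
      (C.op t 0 φ) (W t)]
  ring

/-! ### The perturbed generator -/

section Perturbed

variable {A : ℝ → H →L[ℂ] H} {D : Submodule ℂ H} {T : ℝ → H ≃ₗᵢ[ℂ] H}
  {hT_D : ∀ t, T t '' D = D} {hT_C1 : ∀ ψ ∈ D, ContDiff ℝ 1 fun t => T t ψ}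

theorem isSymmetric_conjBounded (T : H ≃ₗᵢ[ℂ] H) {B : H →L[ℂ] H} (hB : IsSelfAdjoint B) :
    (conjBounded T B).IsSymmetric := fun x y => by
  have h1 : ∀ x, conjBounded T B x = T (B (T.symm x)) := fun _ => rfl
  have h2 := (ContinuousLinearMap.isSelfAdjoint_iff_isSymmetric.1 hB).apply_clm
    (T.symm x) (T.symm y)
  rw [h1, h1, ← LinearIsometryEquiv.inner_map_map T.symm, ← LinearIsometryEquiv.inner_map_map T.symm
    x, T.symm_apply_apply, T.symm_apply_apply]
  exact h2

theorem isSelfAdjoint_perturbedGenerator (hA_sa : ∀ t, IsSelfAdjoint (A t))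
    (hX : ∀ t, IsSelfAdjoint (generator D T hT_D hT_C1 t)) (t : ℝ) :
    IsSelfAdjoint (perturbedGenerator D T hT_D hT_C1 A t) :=
  isSelfAdjoint_vadd (isSymmetric_conjBounded (T t) (hA_sa t)) (hX t)

/-- For `ψ ∈ D` and a test function `χ`, the function `f = χ Tψ` is in the domain of the operator
`-i∂ₜ + ∫^⊕ Y(t) dt`, and this operator maps it to `T (-iχ'ψ + χAψ)`. -/
theorem exists_mem_graph_floquet
    (hA_meas : ∀ ψ : H, AEStronglyMeasurable (fun t => A t ψ) (volume : Measure ℝ))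
    (hA_bdd : ∀ a b : ℝ, ∃ M : ℝ, ∀ t ∈ Set.Icc a b, ‖A t‖ ≤ M)
    (hT_cont : ∀ ψ : H, Continuous fun t => T t ψ)
    {χ : ℝ → ℝ} (hχ : ContDiff ℝ ∞ χ) (hχc : HasCompactSupport χ) {ψ : H} (hψ : ψ ∈ D) :
    ∃ f g : LTwo H, (f, g) ∈ (floquet (perturbedGenerator D T hT_D hT_C1 A)).graph ∧
      (∀ᵐ t, f t = T t (χ t • ψ)) ∧
      ∀ᵐ t, g t = T t (-Complex.I • (deriv χ t • ψ) + χ t • A t ψ) := by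
  have hχ1 : ContDiff ℝ 1 χ := hχ.of_le (by exact_mod_cast le_top)
  have hTr : ∀ (t r : ℝ) (x : H), T t (r • x) = r • T t x := fun t r x => by
    rw [← Complex.coe_smul, ← Complex.coe_smul, map_smul]
  let f₀ : ℝ → H := fun t => χ t • T t ψ
  have hf₀ : ContDiff ℝ 1 f₀ := hχ1.smul (hT_C1 ψ hψ)
  have hf₀c : HasCompactSupport f₀ := hχc.smul_right
  have hf₀d : ∀ t, deriv f₀ t = χ t • deriv (fun u => T u ψ) t + deriv χ t • T t ψ := fun t =>
    ((hχ1.differentiable one_ne_zero t).hasDerivAt.smul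
      ((hT_C1 ψ hψ).differentiable one_ne_zero t).hasDerivAt).deriv
  have mf : MemLp f₀ 2 (volume : Measure ℝ) :=
    hf₀.continuous.memLp_of_hasCompactSupport hf₀c
  have mg₁ : MemLp (fun t => -Complex.I • deriv f₀ t) 2 (volume : Measure ℝ) :=
    ((hf₀.continuous_deriv le_rfl).memLp_of_hasCompactSupport hf₀c.deriv).const_smul _
  have mA : MemLp (fun t => χ t • A t ψ) 2 (volume : Measure ℝ) := by
    obtain ⟨R, hR⟩ := hχc.isCompact.isBounded.subset_closedBall 0
    rw [Real.closedBall_eq_Icc, zero_sub, zero_add] at hR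
    obtain ⟨M, hM0, hM⟩ := exists_norm_family_le hA_bdd R
    refine MemLp.of_le_mul (c := M * ‖ψ‖) (hχ.continuous.memLp_of_hasCompactSupport hχc)
      (hχ.continuous.aestronglyMeasurable.smul (hA_meas ψ))
      (Filter.Eventually.of_forall fun t => ?_)
    rw [norm_smul, mul_comm]
    by_cases ht : t ∈ Set.Icc (-R) R
    · exact mul_le_mul_of_nonneg_right ((A t).le_of_opNorm_le (hM t ht) ψ) (norm_nonneg _)
    · rw [image_eq_zero_of_notMem_tsupport fun h => ht (hR h)]
      simp
  have mTA : MemLp (fun t => χ t • T t (A t ψ)) 2 (volume : Measure ℝ) := by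
    refine (memLp_unitary_apply T hT_cont (mA.toLp _)).ae_eq ?_
    filter_upwards [mA.coeFn_toLp] with t ht
    rw [ht, hTr]
  have mX : MemLp (fun t => χ t • (Complex.I • deriv (fun u => T u ψ) t)) 2
      (volume : Measure ℝ) :=
    (hχ.continuous.smul (((hT_C1 ψ hψ).continuous_deriv le_rfl).const_smul
      Complex.I)).memLp_of_hasCompactSupport hχc.smul_right
  have mg₂ : MemLp (fun t => χ t • (Complex.I • deriv (fun u => T u ψ) t + T t (A t ψ))) 2
      (volume : Measure ℝ) := by
    exact (mX.add mTA).ae_eq (Filter.Eventually.of_forall fun t => (smul_add _ _ _).symm)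
  refine ⟨mf.toLp _, mg₁.toLp _ + mg₂.toLp _, mem_graph_add_iff.2 ⟨_, _, ?_, ?_, rfl⟩, ?_, ?_⟩
  · rw [derivOp_graph, mem_derivGraph_iff]
    refine ⟨f₀, mf.coeFn_toLp, (IsPrimitive.of_contDiff hf₀).congr ?_⟩
    filter_upwards [mg₁.coeFn_toLp] with t ht
    rw [ht, smul_smul]
    simp
  · rw [directIntegral_graph]
    change ∀ᵐ t, ∃ h : mf.toLp _ t ∈ (perturbedGenerator D T hT_D hT_C1 A t).domain,
      mg₂.toLp _ t = perturbedGenerator D T hT_D hT_C1 A t ⟨mf.toLp _ t, h⟩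
    filter_upwards [mf.coeFn_toLp, mg₂.coeFn_toLp] with t h1 h2
    have hD : χ t • T t ψ ∈ D := by
      have h3 : T t ψ ∈ (D : Set H) := by rw [← hT_D t]; exact ⟨ψ, hψ, rfl⟩
      rw [← Complex.coe_smul]
      exact D.smul_mem _ h3
    have h4 := perturbedGenerator_apply (hT_D := hT_D) (hT_C1 := hT_C1) (A := A) hψ (χ t) hD
    refine ⟨by rw [h1]; exact hD, ?_⟩
    rw [h2, ← h4]
    congr 1
    exact Subtype.ext h1.symm
  · filter_upwards [mf.coeFn_toLp] with t ht
    rw [ht, hTr]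
  · filter_upwards [Lp.coeFn_add (mg₁.toLp _) (mg₂.toLp _), mg₁.coeFn_toLp, mg₂.coeFn_toLp]
      with t h1 h2 h3
    -- The contributions `∓iχṪψ` of `-i∂ₜ` and of `X` cancel here.
    rw [h1, Pi.add_apply, h2, h3, hf₀d, map_add, map_smul, hTr, hTr, smul_add, smul_add,
      neg_smul, neg_smul, smul_comm Complex.I (χ t)]
    abel

/-- The functions `χ Tψ` already have trivial orthogonal complement: if `u` is orthogonal to all of
them, `T⁻¹u` vanishes against every `χψ`. -/
theorem dense_domain_floquet
    (hA_meas : ∀ ψ : H, AEStronglyMeasurable (fun t => A t ψ) (volume : Measure ℝ))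
    (hA_bdd : ∀ a b : ℝ, ∃ M : ℝ, ∀ t ∈ Set.Icc a b, ‖A t‖ ≤ M)
    (hD : Dense (D : Set H)) (hT_cont : ∀ ψ : H, Continuous fun t => T t ψ) :
    Dense ((floquet (perturbedGenerator D T hT_D hT_C1 A)).domain : Set (LTwo H)) := by
  rw [Submodule.dense_iff_topologicalClosure_eq_top, Submodule.topologicalClosure_eq_top_iff,
    Submodule.eq_bot_iff]
  intro u hu
  have hu' := memLp_symm_apply hT_cont u
  have h0 : ∀ᵐ t, (T t).symm (u t) = 0 := by
    refine ae_eq_zero_of_integral_mul_inner hD (hu'.locallyIntegrable (by norm_num))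
      fun χ hχ hχc ψ hψ => ?_
    obtain ⟨f, g, hfg, hf, -⟩ := exists_mem_graph_floquet (hT_D := hT_D) (hT_C1 := hT_C1)
      hA_meas hA_bdd hT_cont hχ hχc hψ
    rw [← (Submodule.mem_orthogonal _ u).1 hu f (LinearPMap.mem_domain_of_mem_graph hfg),
      L2.inner_def]
    refine integral_congr_ae ?_
    filter_upwards [hf] with t ht
    rw [ht, ← LinearIsometryEquiv.inner_map_map (T t).symm (T t _),
      LinearIsometryEquiv.symm_apply_apply, ← Complex.coe_smul, inner_smul_left,
      Complex.conj_ofReal]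
  ext1
  filter_upwards [h0, Lp.coeFn_zero H 2 (volume : Measure ℝ)] with t h1 h2
  rw [h2]
  exact (LinearIsometryEquiv.map_eq_zero_iff _).1 h1

/-- Pairing with the functions `χ Tψ` turns membership in the adjoint into a weak differential
equation for `T⁻¹u`, and `C(0,t)` integrates it. -/
theorem adjoint_floquet_le_quasiEnergy (hA_sa : ∀ t, IsSelfAdjoint (A t))
    (hA_meas : ∀ ψ : H, AEStronglyMeasurable (fun t => A t ψ) (volume : Measure ℝ))
    (hA_bdd : ∀ a b : ℝ, ∃ M : ℝ, ∀ t ∈ Set.Icc a b, ‖A t‖ ≤ M)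
    (hD : Dense (D : Set H)) (hT_cont : ∀ ψ : H, Continuous fun t => T t ψ)
    {C : Propagator H} (hC : ∀ φ, IsSolution A fun t => C.op t 0 φ) :
    (floquet (perturbedGenerator D T hT_D hT_C1 A)).graph.adjoint ≤
      (quasiEnergy (C.conj T hT_cont)).graph := by
  rintro ⟨u, v⟩ huv
  have hu' := memLp_symm_apply hT_cont u
  have hv' := memLp_symm_apply hT_cont v
  set u' : ℝ → H := fun t => (T t).symm (u t)
  set v' : ℝ → H := fun t => (T t).symm (v t)
  have lu : LocallyIntegrable u' := hu'.locallyIntegrable (by norm_num)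
  have lv : LocallyIntegrable v' := hv'.locallyIntegrable (by norm_num)
  have lA : LocallyIntegrable fun t => A t (u' t) :=
    locallyIntegrable_family_apply hA_meas hA_bdd lu
  have lw : LocallyIntegrable fun t => Complex.I • (v' t - A t (u' t)) :=
    (lv.sub lA).smul Complex.I
  obtain ⟨W, huW, hW⟩ := exists_isPrimitive_of_weak_deriv hD lu lw fun χ hχ hχc ψ hψ => by
    have hχ' : Continuous (deriv χ) := hχ.continuous_deriv (by exact_mod_cast le_top)
    obtain ⟨f, g, hfg, hf, hg⟩ := exists_mem_graph_floquet (hT_D := hT_D) (hT_C1 := hT_C1)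
      hA_meas hA_bdd hT_cont hχ hχc hψ
    have h1 := mem_adjoint_iff'.1 huv _ hfg
    rw [L2.inner_def, L2.inner_def] at h1
    have e1 : ∫ t, inner ℂ (g t) (u t) =
        ∫ t, (Complex.I * (((deriv χ t : ℝ) : ℂ) * inner ℂ ψ (u' t)) +
          (χ t : ℂ) * inner ℂ ψ (A t (u' t))) := by
      refine integral_congr_ae ?_
      filter_upwards [hg] with t ht
      rw [ht, ← LinearIsometryEquiv.inner_map_map (T t).symm (T t _),
        LinearIsometryEquiv.symm_apply_apply, ← Complex.coe_smul, ← Complex.coe_smul,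
        inner_add_left, inner_smul_left, inner_smul_left, inner_smul_left,
        Complex.conj_ofReal, Complex.conj_ofReal, map_neg, Complex.conj_I, neg_neg,
        (ContinuousLinearMap.isSelfAdjoint_iff_isSymmetric.1 (hA_sa t)).apply_clm]
    have e2 : ∫ t, inner ℂ (f t) (v t) = ∫ t, (χ t : ℂ) * inner ℂ ψ (v' t) := by
      refine integral_congr_ae ?_
      filter_upwards [hf] with t ht
      rw [ht, ← LinearIsometryEquiv.inner_map_map (T t).symm (T t _),
        LinearIsometryEquiv.symm_apply_apply, ← Complex.coe_smul, inner_smul_left,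
        Complex.conj_ofReal]
    have i1 := integrable_mul_inner hχ' hχc.deriv lu ψ
    have i2 := integrable_mul_inner hχ.continuous hχc lA ψ
    have i3 := integrable_mul_inner hχ.continuous hχc lv ψ
    rw [e1, e2, integral_add (i1.const_mul _) i2, integral_const_mul] at h1
    have e3 : ∫ t, (χ t : ℂ) * inner ℂ ψ (Complex.I • (v' t - A t (u' t))) =
        Complex.I * ((∫ t, (χ t : ℂ) * inner ℂ ψ (v' t)) -
          ∫ t, (χ t : ℂ) * inner ℂ ψ (A t (u' t))) := by
      rw [← integral_sub i3 i2, ← integral_const_mul]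
      refine integral_congr_ae (Filter.Eventually.of_forall fun t => ?_)
      simp only [inner_smul_right, inner_sub_right]
      ring
    rw [e3, ← h1, add_sub_cancel_right, ← mul_assoc, Complex.I_mul_I, neg_one_mul, neg_neg]
  have hW' : IsPrimitive W fun t => Complex.I • (v' t - A t (W t)) := by
    refine hW.congr ?_
    filter_upwards [huW] with t ht
    rw [ht]
  -- The conjugated propagator at `(t,0)` has inverse `T(0) C(0,t) T(t)⁻¹`, so the constant unitary
  -- `T(0)` has to be applied as well.
  have hG := (IsPrimitive.propagator_apply hA_sa hC hv' hW').clm_apply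
    (((T 0).toContinuousLinearEquiv : H →L[ℂ] H).restrictScalars ℝ)
  have hsymm : ∀ t x, ((C.conj T hT_cont).op t 0).symm x = T 0 (C.op 0 t ((T t).symm x)) :=
    fun t x => congrArg (T 0) (C.symm_op t 0 ((T t).symm x))
  rw [quasiEnergy, mem_graph_unitaryConj_iff, derivOp_graph, mem_derivGraph_iff]
  refine ⟨_, ?_, hG.congr ?_⟩
  · filter_upwards [decomposableUnitary_symm_ae (fun t => (C.conj T hT_cont).op t 0) _ u, huW]
      with t h1 h2
    rw [h1, hsymm]
    change T 0 (C.op 0 t (u' t)) = T 0 (C.op 0 t (W t))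
    rw [h2]
  · filter_upwards [decomposableUnitary_symm_ae (fun t => (C.conj T hT_cont).op t 0) _ v]
      with t h1
    rw [h1, hsymm]
    exact (T 0).map_smul _ _

end Perturbed

end

end

end WeakAssoc

/-! ### The main theorem. -/

open WeakAssoc in
theorem mainTheorem6 {H : Type*} [NormedAddCommGroup H] [InnerProductSpace ℂ H] [CompleteSpace H]
    [TopologicalSpace.SeparableSpace H]
    (A : ℝ → H →L[ℂ] H)
    (hA_sa : ∀ t, IsSelfAdjoint (A t))
    (hA_meas : ∀ ψ : H, AEStronglyMeasurable (fun t => A t ψ) (volume : Measure ℝ))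
    (hA_bdd : ∀ a b : ℝ, ∃ M : ℝ, ∀ t ∈ Set.Icc a b, ‖A t‖ ≤ M)
    (D : Submodule ℂ H) (hD : Dense (D : Set H))
    (T : ℝ → H ≃ₗᵢ[ℂ] H)
    (hT_cont : ∀ ψ : H, Continuous fun t => T t ψ)
    (hT_D : ∀ t, T t '' D = D)
    (hT_C1 : ∀ ψ ∈ D, ContDiff ℝ 1 fun t => T t ψ)
    (hX : ∀ t, IsSelfAdjoint (WeakAssoc.generator D T hT_D hT_C1 t)) :
    (∃! C : WeakAssoc.Propagator H, WeakAssoc.IsDysonPropagator A C) ∧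
      ∀ C : WeakAssoc.Propagator H, WeakAssoc.IsDysonPropagator A C →
        WeakAssoc.WeaklyAssociated (C.conj T hT_cont)
            (WeakAssoc.perturbedGenerator D T hT_D hT_C1 A) ∧
          WeakAssoc.IsEssentiallySelfAdjoint
            (WeakAssoc.floquet (WeakAssoc.perturbedGenerator D T hT_D hT_C1 A)) := by
  refine ⟨existsUnique_isDysonPropagator hA_sa hA_meas hA_bdd, fun C hC => ?_⟩
  have hY := isSelfAdjoint_perturbedGenerator (hT_D := hT_D) (hT_C1 := hT_C1) hA_sa hX
  have hd := dense_domain_floquet (hT_D := hT_D) (hT_C1 := hT_C1) hA_meas hA_bdd hD hT_cont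
  obtain ⟨hc, hK, hs⟩ := closure_eq_of_adjoint_le hd
    (isSymmetricGraph_floquet fun t => isSymmetricGraph_of_isSelfAdjoint (hY t))
    (isSymmetricGraph_derivOp.unitaryConj)
    (adjoint_floquet_le_quasiEnergy hA_sa hA_meas hA_bdd hD hT_cont
      (hC.isSolution hA_meas hA_bdd 0))
  exact ⟨⟨hY, hd, hc, hK⟩, hd, hc, hs⟩
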